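/- Let $\alpha\in(0,2)$. Consider the two-dimensional directed lattice with vertex set $\mathbb N^2$ (where $0\in\mathbb N$) and edges $v\to v+e_1$, $v\to v+e_2$. Let $(r(v))_{v\in\mathbb N^2}$ be independent random rewards, each Pareto distributed with index $\alpha$ and some scale $x_m>0$, i.e. $\mathbb P(r(v)\le x)=1-(x_m/x)^\alpha$ for $x\ge x_m$ and $\mathbb P(r(v)\le x)=0$ for $x<x_m$. Let $T^*_2(n)$ be the maximum, over all directed paths that start at the origin and cross exactly $n$ vertices (the origin included), of the sum of the rewards of the vertices on the path, and let $R^*_2(n)=T^*_2(n)/n$. Then: 1. The optimal mean reward is infinite: $\lim_{n\to\infty}\mathbb E[R^*_2(n)]=\infty$ (in $[0,\infty]$). 2. $T^*_2(n)$ is of order $n^{2/\alpha}$, and $R^*_2(n)$ of order $n^{2/\alpha-1}$, in probability: for every $\varepsilon>0$ there are constants $c,C>0$, depending only on $\alpha$ and $\varepsilon$, such that for all $n\ge 1$ $$\mathbb P\bigl(c\,x_m\,n^{2/\alpha}\le T^*_2(n)\le C\,x_m\,n^{2/\alpha}\bigr)\ge 1-\varepsilon,\qquad \mathbb P\bigl(c\,x_m\,n^{2/\alpha-1}\le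 R^*_2(n)\le C\,x_m\,n^{2/\alpha-1}\bigr)\ge 1-\varepsilon .$$ 3. There is a finite random variable $T$, whose law depends only on $\alpha$, which is almost surely positive and not almost surely constant, such that, as $n\to\infty$, both $T^*_2(n)/n^{2/\alpha}$ and $R^*_2(n)/n^{2/\alpha-1}$ converge in distribution to $x_m\,T$. -/

import Mathlib

open MeasureTheory ProbabilityTheory Filter Topology
open scoped ENNReal

namespace LatticeReward

/-- Edges of the `d`-dimensional directed regular lattice on `ℕ^d`: `w` is obtained from `v` by
increasing exactly one coordinate by one. -/
def LatticeEdge {d : ℕ} (v w : Fin d → ℕ) : Prop :=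
  ∃ k : Fin d, w = v + Pi.single k 1

/-- The directed lattice paths that start at `v₀` and cross exactly `n` vertices
(the starting vertex `v₀` is the first of them). -/
def latticePaths {d : ℕ} (v₀ : Fin d → ℕ) (n : ℕ) : Set (Fin n → (Fin d → ℕ)) :=
  {π | (∀ h : 0 < n, π ⟨0, h⟩ = v₀) ∧
    ∀ (i : ℕ) (h : i + 1 < n), LatticeEdge (π ⟨i, by omega⟩) (π ⟨i + 1, h⟩)}

/-- The maximum total reward of a lattice path that starts at `v₀` and crosses `n` vertices, for
the reward field `r`. Directed paths visit every vertex at most once, so the sum over the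
indices is the sum over the visited vertices. The supremum is attained
(see `isGreatest_maxTotalReward`). -/
noncomputable def maxTotalReward {d : ℕ} (r : (Fin d → ℕ) → ℝ) (v₀ : Fin d → ℕ) (n : ℕ) : ℝ :=
  sSup ((fun π : Fin n → (Fin d → ℕ) => ∑ i, r (π i)) '' latticePaths v₀ n)

/-- `T*_d(n)`: the maximum total reward for paths from the origin crossing `n` vertices. -/
noncomputable def Tstar {d : ℕ} (r : (Fin d → ℕ) → ℝ) (n : ℕ) : ℝ :=
  maxTotalReward r 0 n

/-- `R*_d(n) = T*_d(n) / n`: the maximum mean reward. -/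
noncomputable def Rstar {d : ℕ} (r : (Fin d → ℕ) → ℝ) (n : ℕ) : ℝ :=
  Tstar r n / n

/-- Independent rewards on the vertices of the lattice `ℕ^d`, each with the Pareto distribution
with scale `xm` and index `α`. -/
structure IsParetoField {Ω : Type*} [MeasurableSpace Ω] {d : ℕ}
    (xm α : ℝ) (r : (Fin d → ℕ) → Ω → ℝ) (P : Measure Ω) : Prop where
  indep : iIndepFun r P
  law : ∀ v, HasLaw (r v) (paretoMeasure xm α) P

theorem latticePaths_finite {d : ℕ} (v₀ : Fin d → ℕ) (n : ℕ) : (latticePaths v₀ n).Finite := by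
  refine Set.Finite.subset
    (Set.Finite.pi' (fun i : Fin n => Set.finite_Iic (v₀ + fun _ => (i : ℕ)))) ?_
  rintro π ⟨h0, hs⟩ ⟨i, hi⟩
  induction i with
  | zero => intro k; simp [h0 hi]
  | succ i ih =>
    intro k
    obtain ⟨j, hj⟩ := hs i hi
    have h1 := ih (by omega) k
    have h2 : (Pi.single j 1 : Fin d → ℕ) k ≤ 1 := by
      by_cases h : k = j
      · subst h; simp
      · simp [h]
    rw [hj]
    simp only [Pi.add_apply] at h1 ⊢
    omega

theorem latticePaths_nonempty {d : ℕ} (hd : 0 < d) (v₀ : Fin d → ℕ) (n : ℕ) :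
    (latticePaths v₀ n).Nonempty := by
  refine ⟨fun i => v₀ + Pi.single ⟨0, hd⟩ (i : ℕ), fun h => by simp, fun i h => ⟨⟨0, hd⟩, ?_⟩⟩
  simp [add_assoc, ← Pi.single_add]

theorem isGreatest_maxTotalReward {d : ℕ} (hd : 0 < d) (r : (Fin d → ℕ) → ℝ)
    (v₀ : Fin d → ℕ) (n : ℕ) :
    IsGreatest ((fun π : Fin n → (Fin d → ℕ) => ∑ i, r (π i)) '' latticePaths v₀ n)
      (maxTotalReward r v₀ n) := by
  have hf := (latticePaths_finite v₀ n).image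
    (fun π : Fin n → (Fin d → ℕ) => ∑ i, r (π i))
  exact ⟨((latticePaths_nonempty hd v₀ n).image _).csSup_mem hf,
    fun x hx => le_csSup hf.bddAbove hx⟩

end LatticeReward

open scoped BoundedContinuousFunction NNReal

/-! For nonnegative rewards some path crosses any given chain of the product order in `triangle n`,
so `T*` is the weight of the heaviest chain (`Tstar_eq_chainMax`). The triangle has of order n²
vertices, and a Pareto reward of scale 1 exceeds δ n^(2/α) with probability δ^(-α)/n² (once this
level is at least 1). Hence the largest reward is of order n^(2/α), and it alone gives the lower
bound (`measureReal_chainMax_le_le`).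

The condition α < 2 makes the small rewards negligible. If a reward exceeds t with probability at
most p, a chain meets on average at most of order n√p such vertices (`integral_exceedCount_le`, by
an exponential moment). Summing over dyadic levels below δ n^(2/α) bounds the mean contribution of
these rewards by a multiple of δ^(1-α/2) n^(2/α) (`integral_truncMax_le`), which is small with δ,
uniformly in n. The upper bound follows.

For the limit law, cut the lattice into squares of side n/K and keep one maximum per square. For K
large, the rewards above δ n^(2/α) lie with high probability in different rows and columns of
squares, so the heaviest chain is close to the heaviest chain of square maxima
(`exists_block_approx`). For fixed K these maxima are independent and identically distributed.
Realised as quantiles of one uniform family, they converge almost surely after scaling, so integrals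
of bounded continuous functions converge (`tendsto_integral_block`). Uniformity of the approximation
gives convergence for the heaviest chain itself, against bounded Lipschitz functions, and tightness
then yields a limit law ν (`exists_tendsto_of_isTight`).

The estimate P(T < c) ≤ exp(-c^(-α)/4) survives in the limit. It tends to 0 as c → 0, so ν charges
only positive numbers; it is below 1 for every c, so ν is no point mass. The joint law of the
rewards determines ν, and the scale factors out. The mean diverges because 2/α - 1 > 0 in the lower
bound. -/

namespace LatticeReward

/-! ### Chains in a triangle and their maximal weight. -/

/-- The vertices of `ℕ^2` that a directed path from the origin crossing `n` vertices can reach. -/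
def triangle (n : ℕ) : Finset (Fin 2 → ℕ) :=
  (Finset.Iic (fun _ => n)).filter (fun v => v 0 + v 1 < n)

@[simp] theorem mem_triangle {n : ℕ} {v : Fin 2 → ℕ} : v ∈ triangle n ↔ v 0 + v 1 < n := by
  simp only [triangle, Finset.mem_filter, Finset.mem_Iic, and_iff_right_iff_imp, Pi.le_def,
    Fin.forall_fin_two]
  omega

open Classical in
/-- The subsets of `triangle n` that are chains for the relation `R`. -/
noncomputable def chains (R : (Fin 2 → ℕ) → (Fin 2 → ℕ) → Prop) (n : ℕ) :
    Finset (Finset (Fin 2 → ℕ)) :=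
  (triangle n).powerset.filter (fun A => IsChain R (A : Set (Fin 2 → ℕ)))

theorem mem_chains {R : (Fin 2 → ℕ) → (Fin 2 → ℕ) → Prop} {n : ℕ} {A : Finset (Fin 2 → ℕ)} :
    A ∈ chains R n ↔ A ⊆ triangle n ∧ IsChain R (A : Set (Fin 2 → ℕ)) := by
  simp [chains]

theorem chains_nonempty (R : (Fin 2 → ℕ) → (Fin 2 → ℕ) → Prop) (n : ℕ) :
    (chains R n).Nonempty :=
  ⟨∅, by simp [mem_chains]⟩

/-- The maximal weight of an `R`-chain in `triangle n`. -/
noncomputable def chainMax (R : (Fin 2 → ℕ) → (Fin 2 → ℕ) → Prop) (w : (Fin 2 → ℕ) → ℝ)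
    (n : ℕ) : ℝ :=
  (chains R n).sup' (chains_nonempty R n) (fun A => ∑ v ∈ A, w v)

section chainMax
variable {R : (Fin 2 → ℕ) → (Fin 2 → ℕ) → Prop} {w : (Fin 2 → ℕ) → ℝ} {n : ℕ}

theorem sum_le_chainMax {A : Finset (Fin 2 → ℕ)} (h : A ⊆ triangle n)
    (hA : IsChain R (A : Set (Fin 2 → ℕ))) : ∑ v ∈ A, w v ≤ chainMax R w n :=
  Finset.le_sup' (fun A => ∑ v ∈ A, w v) (mem_chains.2 ⟨h, hA⟩)

theorem chainMax_le {x : ℝ} (h : ∀ A ⊆ triangle n, IsChain R (A : Set (Fin 2 → ℕ)) →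
    ∑ v ∈ A, w v ≤ x) : chainMax R w n ≤ x :=
  Finset.sup'_le _ _ fun A hA => h A (mem_chains.1 hA).1 (mem_chains.1 hA).2

theorem chainMax_nonneg : 0 ≤ chainMax R w n := by
  simpa using sum_le_chainMax (R := R) (w := w) (n := n) (A := ∅) (by simp) (by simp)

theorem exists_chain_eq (R : (Fin 2 → ℕ) → (Fin 2 → ℕ) → Prop) (w : (Fin 2 → ℕ) → ℝ) (n : ℕ) :
    ∃ A ⊆ triangle n, IsChain R (A : Set (Fin 2 → ℕ)) ∧ chainMax R w n = ∑ v ∈ A, w v := by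
  obtain ⟨A, hA, h⟩ := Finset.exists_mem_eq_sup' (chains_nonempty R n) (fun A => ∑ v ∈ A, w v)
  exact ⟨A, (mem_chains.1 hA).1, (mem_chains.1 hA).2, h⟩

theorem le_chainMax {v : Fin 2 → ℕ} (hv : v ∈ triangle n) : w v ≤ chainMax R w n := by
  simpa using sum_le_chainMax (R := R) (w := w) (n := n) (A := {v}) (by simpa using hv) (by simp)

theorem chainMax_const_mul {x : ℝ} (hx : 0 ≤ x) :
    chainMax R (fun v => x * w v) n = x * chainMax R w n := by
  apply le_antisymm
  · refine chainMax_le fun A h hA => ?_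
    rw [← Finset.mul_sum]
    exact mul_le_mul_of_nonneg_left (sum_le_chainMax h hA) hx
  · obtain ⟨A, h, hA, e⟩ := exists_chain_eq R w n
    rw [e, Finset.mul_sum]
    exact sum_le_chainMax (w := fun v => x * w v) h hA

theorem chainMax_div {x : ℝ} (hx : 0 ≤ x) :
    chainMax R (fun v => w v / x) n = chainMax R w n / x := by
  simp only [div_eq_inv_mul _ x]
  exact chainMax_const_mul (inv_nonneg.2 hx)

theorem continuous_chainMax (R : (Fin 2 → ℕ) → (Fin 2 → ℕ) → Prop) (n : ℕ) :
    Continuous (fun w : (Fin 2 → ℕ) → ℝ => chainMax R w n) := by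
  unfold chainMax
  exact Continuous.finset_sup'_apply (chains_nonempty R n)
    (fun A _ => continuous_finsetSum A fun v _ => continuous_apply v)

theorem measurable_chainMax (R : (Fin 2 → ℕ) → (Fin 2 → ℕ) → Prop) (n : ℕ) :
    Measurable (fun w : (Fin 2 → ℕ) → ℝ => chainMax R w n) :=
  (continuous_chainMax R n).measurable

theorem strictMono_coordSum : StrictMono (fun v : Fin 2 → ℕ => v 0 + v 1) := by
  intro u v h
  obtain ⟨h1, i, hi⟩ := Pi.lt_def.1 h
  have h0 : u 0 ≤ v 0 := h1 0
  have h1 : u 1 ≤ v 1 := h1 1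
  fin_cases i <;> simp at hi ⊢ <;> omega

/-- The coordinate sum is strictly monotone, hence injective on a chain, and takes `n` values on the
triangle. -/
theorem card_le_of_isChain {A : Finset (Fin 2 → ℕ)} (h : A ⊆ triangle n)
    (hA : IsChain (· ≤ ·) (A : Set (Fin 2 → ℕ))) : A.card ≤ n := by
  rw [← Finset.card_range n]
  refine Finset.card_le_card_of_injOn (fun v => v 0 + v 1) (fun v hv => ?_) ?_
  · simpa using h hv
  · intro u hu v hv e
    by_contra hne
    rcases hA hu hv hne with h' | h'
    · exact (strictMono_coordSum (lt_of_le_of_ne h' hne)).ne e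
    · exact (strictMono_coordSum (lt_of_le_of_ne h' (Ne.symm hne))).ne e.symm

end chainMax

/-! ### Directed paths and chains. -/

theorem LatticeEdge.lt {v w : Fin 2 → ℕ} (h : LatticeEdge v w) : v < w := by
  obtain ⟨k, rfl⟩ := h
  simp

theorem LatticeEdge.coordSum {v w : Fin 2 → ℕ} (h : LatticeEdge v w) :
    w 0 + w 1 = v 0 + v 1 + 1 := by
  obtain ⟨k, rfl⟩ := h
  fin_cases k <;> simp <;> omega

theorem latticePaths_strictMono {n : ℕ} {π : Fin n → Fin 2 → ℕ} (h : π ∈ latticePaths 0 n) :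
    StrictMono π := by
  cases n with
  | zero => exact fun i => i.elim0
  | succ n => exact Fin.strictMono_iff_lt_succ.2 fun i => (h.2 i (by omega)).lt

theorem latticePaths_coordSum {n : ℕ} {π : Fin n → Fin 2 → ℕ} (h : π ∈ latticePaths 0 n)
    (i : ℕ) (hi : i < n) : π ⟨i, hi⟩ 0 + π ⟨i, hi⟩ 1 = i := by
  induction i with
  | zero => simp [h.1 hi]
  | succ i ih => rw [(h.2 i hi).coordSum, ih]

/-- Every chain below `u` is crossed by a directed path from the origin to `u`. -/
theorem exists_path_through (n : ℕ) : ∀ (u : Fin 2 → ℕ), u 0 + u 1 = n →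
    ∀ A : Finset (Fin 2 → ℕ), IsChain (· ≤ ·) (A : Set (Fin 2 → ℕ)) → (∀ v ∈ A, v ≤ u) →
    ∃ π ∈ latticePaths (0 : Fin 2 → ℕ) (n + 1), π (Fin.last n) = u ∧ ∀ v ∈ A, ∃ i, π i = v := by
  induction n with
  | zero =>
    intro u hu A hA hAu
    have hu0 : u = 0 := by ext i; fin_cases i <;> simp <;> omega
    refine ⟨fun _ => 0, ⟨fun _ => rfl, fun i hi => by omega⟩, hu0.symm, fun v hv => ⟨0, ?_⟩⟩
    have := hAu v hv
    rw [hu0] at this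
    exact (le_antisymm this (zero_le)).symm
  | succ n ih =>
    intro u hu A hA hAu
    -- The last edge into `u` must come from a vertex above the rest of the chain. The greatest
    -- remaining element `m` is smaller than `u` in some coordinate `k`, which is the one to
    -- decrease; if nothing remains, any nonzero coordinate will do.
    obtain ⟨k, hk, hlt⟩ : ∃ k, u k ≠ 0 ∧ ∀ v ∈ A.erase u, v ≤ u - Pi.single k 1 := by
      by_cases hne : (A.erase u).Nonempty
      · obtain ⟨m, hm, hmax⟩ := (A.erase u).exists_maximal hne
        have hm' := Finset.mem_erase.1 hm
        have hmu : m < u := lt_of_le_of_ne (hAu m hm'.2) hm'.1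
        obtain ⟨h1, k, hk⟩ := Pi.lt_def.1 hmu
        refine ⟨k, by omega, fun v hv => ?_⟩
        have hvm : v ≤ m := by
          by_cases e : v = m
          · exact e.le
          rcases hA (Finset.mem_of_mem_erase hv) hm'.2 e with h | h
          · exact h
          · exact hmax hv h
        intro i
        have h2 : v i ≤ m i := hvm i
        have h3 : m i ≤ u i := h1 i
        by_cases hik : i = k
        · subst hik; simp; omega
        · simp [hik]; omega
      · rw [Finset.not_nonempty_iff_eq_empty] at hne
        by_cases h0 : u 0 = 0
        · exact ⟨1, by omega, by simp [hne]⟩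
        · exact ⟨0, h0, by simp [hne]⟩
    have hadd : u - Pi.single k 1 + Pi.single k 1 = u := by
      ext i
      by_cases hik : i = k
      · subst hik; simp; omega
      · simp [hik]
    have hedge : LatticeEdge (u - Pi.single k 1) u := ⟨k, hadd.symm⟩
    have hsum := hedge.coordSum
    obtain ⟨π, hπ, hlast, hthru⟩ := ih (u - Pi.single k 1) (by omega) (A.erase u)
      (hA.mono (by simp)) hlt
    refine ⟨Fin.snoc (α := fun _ => Fin 2 → ℕ) π u, ⟨fun _ => ?_, fun i hi => ?_⟩, ?_, fun v hv => ?_⟩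
    · have := hπ.1 (by omega)
      rw [← this]
      exact Fin.snoc_castSucc (α := fun _ => Fin 2 → ℕ) u π ⟨0, by omega⟩
    · have e1 : (Fin.snoc (α := fun _ => Fin 2 → ℕ) π u : Fin (n + 1 + 1) → _) ⟨i, by omega⟩
          = π ⟨i, by omega⟩ := Fin.snoc_castSucc (α := fun _ => Fin 2 → ℕ) u π ⟨i, by omega⟩
      rw [e1]
      by_cases hin : i + 1 < n + 1
      · have e2 : (Fin.snoc (α := fun _ => Fin 2 → ℕ) π u : Fin (n + 1 + 1) → _) ⟨i + 1, hi⟩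
          = π ⟨i + 1, hin⟩ := Fin.snoc_castSucc (α := fun _ => Fin 2 → ℕ) u π ⟨i + 1, hin⟩
        rw [e2]
        exact hπ.2 i hin
      · obtain rfl : i = n := by omega
        have e2 : (Fin.snoc (α := fun _ => Fin 2 → ℕ) π u : Fin (i + 1 + 1) → _) ⟨i + 1, hi⟩
          = u := Fin.snoc_last (α := fun _ => Fin 2 → ℕ) u π
        rw [e2]
        have : π ⟨i, by omega⟩ = u - Pi.single k 1 := hlast
        rw [this]
        exact hedge
    · exact Fin.snoc_last (α := fun _ => Fin 2 → ℕ) u π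
    · by_cases hvu : v = u
      · exact ⟨Fin.last _, by rw [hvu]; exact Fin.snoc_last (α := fun _ => Fin 2 → ℕ) u π⟩
      · obtain ⟨i, hi⟩ := hthru v (Finset.mem_erase.2 ⟨hvu, hv⟩)
        exact ⟨i.castSucc, by rw [← hi]; exact Fin.snoc_castSucc (α := fun _ => Fin 2 → ℕ) u π i⟩

/-- For nonnegative rewards, the best path collects the heaviest chain. -/
theorem Tstar_eq_chainMax {w : (Fin 2 → ℕ) → ℝ} (hw : ∀ v, 0 ≤ w v) (n : ℕ) :
    Tstar w n = chainMax (· ≤ ·) w n := by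
  classical
  have hg := isGreatest_maxTotalReward (by norm_num : 0 < 2) w 0 n
  have image_sum : ∀ π ∈ latticePaths (0 : Fin 2 → ℕ) n,
      ∑ i, w (π i) = ∑ v ∈ Finset.univ.image π, w v := fun π hπ => by
    rw [Finset.sum_image fun i _ j _ h => (latticePaths_strictMono hπ).injective h]
  apply le_antisymm
  · obtain ⟨π, hπ, e⟩ := hg.1
    simp only at e
    rw [Tstar, ← e, image_sum π hπ]
    refine sum_le_chainMax (fun v hv => ?_) ?_
    · obtain ⟨i, -, rfl⟩ := Finset.mem_image.1 hv
      rw [mem_triangle, latticePaths_coordSum hπ i i.2]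
      exact i.2
    · rw [Finset.coe_image, Finset.coe_univ]
      exact (latticePaths_strictMono hπ).monotone.isChain_image (isChain_of_trichotomous _)
  · refine chainMax_le fun A h hA => ?_
    cases n with
    | zero =>
      have : A = ∅ := Finset.subset_empty.1 fun v hv => by simpa using h hv
      rw [this, Finset.sum_empty]
      obtain ⟨π, hπ, e⟩ := hg.1
      simp only at e
      rw [Tstar, ← e]
      simp
    | succ n =>
      -- The endpoint: the top of the chain, moved along the first axis up to the last antidiagonal.
      obtain ⟨u, hu, hAu⟩ : ∃ u : Fin 2 → ℕ, u 0 + u 1 = n ∧ ∀ v ∈ A, v ≤ u := by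
        by_cases hne : A.Nonempty
        · obtain ⟨m, hm, hmax⟩ := A.exists_maximal hne
          have hmn := mem_triangle.1 (h hm)
          refine ⟨m + Pi.single 0 (n - (m 0 + m 1)), by simp; omega, fun v hv => ?_⟩
          refine le_trans ?_ (le_add_of_nonneg_right (zero_le))
          by_cases e : v = m
          · exact e.le
          rcases hA hv hm e with h | h
          · exact h
          · exact hmax hv h
        · exact ⟨![n, 0], by simp, by simp [Finset.not_nonempty_iff_eq_empty.1 hne]⟩
      obtain ⟨π, hπ, -, hthru⟩ := exists_path_through n u hu A hA hAu
      refine le_trans ?_ (hg.2 ⟨π, hπ, rfl⟩)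
      simp only
      rw [image_sum π hπ]
      refine Finset.sum_le_sum_of_subset_of_nonneg (fun v hv => ?_) fun _ _ _ => hw _
      obtain ⟨i, hi⟩ := hthru v hv
      exact Finset.mem_image.2 ⟨i, Finset.mem_univ _, hi⟩


/-! ### Generating function of chains and the number of exceedances on a chain. -/

/-- The sum, over the chains `u₁ < ⋯ < uⱼ < v` with `j ≤ k`, of the products `a u₁ ⋯ a uⱼ`. -/
noncomputable def chainGen (a : (Fin 2 → ℕ) → ℝ) : ℕ → (Fin 2 → ℕ) → ℝ
  | 0, _ => 1
  | k + 1, v => 1 + ∑ u ∈ Finset.Iio v, a u * chainGen a k u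

theorem one_le_chainGen {a : (Fin 2 → ℕ) → ℝ} (ha : ∀ v, 0 ≤ a v) (k : ℕ) :
    ∀ v, 1 ≤ chainGen a k v := by
  induction k with
  | zero => exact fun v => le_rfl
  | succ k ih =>
    intro v
    rw [chainGen, le_add_iff_nonneg_right]
    exact Finset.sum_nonneg fun u _ => mul_nonneg (ha u) (zero_le_one.trans (ih u))

/-- The product is one of the nonnegative terms of the sum; the recursion peels off the top of the
chain. -/
theorem prod_le_chainGen {a : (Fin 2 → ℕ) → ℝ} (ha : ∀ v, 0 ≤ a v) (k : ℕ) :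
    ∀ v, ∀ A : Finset (Fin 2 → ℕ), A.card ≤ k → IsChain (· ≤ ·) (A : Set (Fin 2 → ℕ)) →
    (∀ u ∈ A, u < v) → ∏ u ∈ A, a u ≤ chainGen a k v := by
  induction k with
  | zero =>
    intro v A hk _ _
    rw [Finset.card_eq_zero.1 (Nat.le_zero.1 hk)]
    simp [chainGen]
  | succ k ih =>
    intro v A hk hA hv
    by_cases hne : A.Nonempty
    · obtain ⟨m, hm, hmax⟩ := A.exists_maximal hne
      rw [← Finset.mul_prod_erase A a hm]
      have h1 : ∏ u ∈ A.erase m, a u ≤ chainGen a k m := by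
        refine ih m _ (by rw [Finset.card_erase_of_mem hm]; omega) (hA.mono (by simp)) ?_
        intro u hu
        obtain ⟨hne, huA⟩ := Finset.mem_erase.1 hu
        refine lt_of_le_of_ne ?_ hne
        rcases hA huA hm hne with h | h
        · exact h
        · exact hmax huA h
      calc a m * ∏ u ∈ A.erase m, a u ≤ a m * chainGen a k m :=
            mul_le_mul_of_nonneg_left h1 (ha m)
        _ ≤ ∑ u ∈ Finset.Iio v, a u * chainGen a k u :=
            Finset.single_le_sum (f := fun u => a u * chainGen a k u)
              (fun u _ => mul_nonneg (ha u) (zero_le_one.trans (one_le_chainGen ha k u)))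
              (Finset.mem_Iio.2 (hv m hm))
        _ ≤ _ := by rw [chainGen]; linarith
    · rw [Finset.not_nonempty_iff_eq_empty.1 hne, Finset.prod_empty]
      exact one_le_chainGen ha _ v

theorem chainGen_congr {a b : (Fin 2 → ℕ) → ℝ} (k : ℕ) :
    ∀ v, (∀ u < v, a u = b u) → chainGen a k v = chainGen b k v := by
  induction k with
  | zero => exact fun v _ => rfl
  | succ k ih =>
    intro v h
    rw [chainGen, chainGen]
    congr 1
    refine Finset.sum_congr rfl fun u hu => ?_
    have hu := Finset.mem_Iio.1 hu
    rw [h u hu, ih u fun t ht => h t (ht.trans hu)]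

theorem continuous_chainGen (k : ℕ) :
    ∀ v, Continuous (fun a : (Fin 2 → ℕ) → ℝ => chainGen a k v) := by
  induction k with
  | zero => exact fun v => continuous_const
  | succ k ih =>
    intro v
    simp only [chainGen]
    exact continuous_const.add
      (continuous_finsetSum _ fun u _ => (continuous_apply u).mul (ih u))

/-- The relation (1 - s) y = 1 gives s y^(j+1) = y^(j+1) - y^j, so the sum telescopes. -/
theorem sum_geom_pow {s y : ℝ} (h : (1 - s) * y = 1) (m : ℕ) :
    ∑ j ∈ Finset.Iic m, s * y ^ (j + 1) = y ^ (m + 1) - 1 := by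
  have e : Finset.Iic m = Finset.range (m + 1) := by ext; simp
  rw [e]
  clear e
  induction m with
  | zero => simp; linarith
  | succ m ih =>
    rw [Finset.sum_range_succ, ih]
    have : y ^ (m + 1) = (1 - s) * y * y ^ (m + 1) := by rw [h, one_mul]
    rw [pow_succ y (m + 1)]
    nlinarith

/-- This is the supersolution of the recursion of `chainGen` when each factor has mean at most s²:
the sum over the rectangle splits into two geometric sums. -/
theorem one_add_sum_Iio_le {s y : ℝ} (hy : 1 ≤ y) (h : (1 - s) * y = 1)
    (v : Fin 2 → ℕ) :
    1 + ∑ u ∈ Finset.Iio v, s ^ 2 * y ^ (u 0 + u 1 + 2) ≤ y ^ (v 0 + v 1 + 2) := by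
  have h1 : ∑ u ∈ Finset.Iio v, s ^ 2 * y ^ (u 0 + u 1 + 2)
      ≤ ∑ u ∈ Finset.Iic v, s ^ 2 * y ^ (u 0 + u 1 + 2) :=
    Finset.sum_le_sum_of_subset_of_nonneg
      (fun u hu => Finset.mem_Iic.2 (Finset.mem_Iio.1 hu).le) fun _ _ _ => by positivity
  have h2 : ∑ u ∈ Finset.Iic v, s ^ 2 * y ^ (u 0 + u 1 + 2)
      = (y ^ (v 0 + 1) - 1) * (y ^ (v 1 + 1) - 1) := by
    rw [← sum_geom_pow h, ← sum_geom_pow h]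
    have := Finset.prod_univ_sum (fun i : Fin 2 => Finset.Iic (v i))
      (fun _ j => s * y ^ (j + 1))
    rw [Fin.prod_univ_two] at this
    rw [this]
    have e : Finset.Iic v = Fintype.piFinset fun i : Fin 2 => Finset.Iic (v i) := by
      ext u; simp [Pi.le_def]
    rw [e]
    refine Finset.sum_congr rfl fun u _ => ?_
    rw [Fin.prod_univ_two]
    ring
  have h3 : 1 ≤ y ^ (v 0 + 1) := one_le_pow₀ hy
  have h4 : 1 ≤ y ^ (v 1 + 1) := one_le_pow₀ hy
  have h5 : y ^ (v 0 + v 1 + 2) = y ^ (v 0 + 1) * y ^ (v 1 + 1) := by ring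
  rw [h5]
  nlinarith

section Prob
variable {Ω : Type*} [MeasurableSpace Ω] {P : Measure Ω}

/-- `chainGen` at `v` involves only the values strictly below `v`, so expectations in the recursion
factorise. -/
theorem indepFun_chainGen {a : (Fin 2 → ℕ) → Ω → ℝ} (hm : ∀ v, Measurable (a v))
    (hi : iIndepFun a P) (k : ℕ) (v : Fin 2 → ℕ) :
    IndepFun (a v) (fun ω => chainGen (fun u => a u ω) k v) P := by
  classical
  have h := hi.indepFun_finset {v} (Finset.Iio v) (by simp) hm
  let ext : (Finset.Iio v → ℝ) → (Fin 2 → ℕ) → ℝ :=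
    fun x u => if hu : u ∈ Finset.Iio v then x ⟨u, hu⟩ else 0
  have hext : Measurable ext := by
    refine measurable_pi_lambda _ fun u => ?_
    by_cases hu : u ∈ Finset.Iio v
    · simp only [ext, hu, dif_pos]; exact measurable_pi_apply _
    · simp only [ext, hu, dif_neg, not_false_eq_true]; exact measurable_const
  have hev : Measurable (fun x : ({v} : Finset (Fin 2 → ℕ)) → ℝ => x ⟨v, by simp⟩) :=
    measurable_pi_apply _
  have h' := h.comp hev ((continuous_chainGen k v).measurable.comp hext)
  refine h'.congr (ae_of_all _ fun ω => rfl) (ae_of_all _ fun ω => ?_)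
  refine chainGen_congr k v fun u hu => ?_
  simp [ext, hu]

variable [IsProbabilityMeasure P]

theorem integrable_chainGen {a : (Fin 2 → ℕ) → Ω → ℝ} (hm : ∀ v, Measurable (a v))
    (hi : iIndepFun a P) (hint : ∀ v, Integrable (a v) P) (k : ℕ) :
    ∀ v, Integrable (fun ω => chainGen (fun u => a u ω) k v) P := by
  induction k with
  | zero => exact fun v => integrable_const _
  | succ k ih =>
    intro v
    simp only [chainGen]
    exact (integrable_const _).add (integrable_finsetSum _ fun u _ =>
      (indepFun_chainGen hm hi k u).integrable_mul (hint u) (ih u))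

theorem integral_chainGen_le {a : (Fin 2 → ℕ) → Ω → ℝ} (hm : ∀ v, Measurable (a v))
    (hi : iIndepFun a P) (hint : ∀ v, Integrable (a v) P) (ha : ∀ v ω, 0 ≤ a v ω) {s y : ℝ}
    (hy : 1 ≤ y) (h : (1 - s) * y = 1) (hE : ∀ v, ∫ ω, a v ω ∂P ≤ s ^ 2) (k : ℕ) :
    ∀ v, ∫ ω, chainGen (fun u => a u ω) k v ∂P ≤ y ^ (v 0 + v 1 + 2) := by
  induction k with
  | zero =>
    intro v
    simp only [chainGen, integral_const, probReal_univ, one_smul]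
    exact one_le_pow₀ hy
  | succ k ih =>
    intro v
    simp only [chainGen]
    have hI : ∀ u, Integrable (fun ω => a u ω * chainGen (fun u => a u ω) k u) P := fun u =>
      (indepFun_chainGen hm hi k u).integrable_mul (hint u) (integrable_chainGen hm hi hint k u)
    rw [integral_add (integrable_const _) (integrable_finsetSum _ fun u _ => hI u),
      integral_finsetSum _ fun u _ => hI u]
    refine le_trans ?_ (one_add_sum_Iio_le hy h v)
    simp only [integral_const, probReal_univ, one_smul]
    refine add_le_add le_rfl (Finset.sum_le_sum fun u _ => ?_)
    rw [(indepFun_chainGen hm hi k u).integral_fun_mul_eq_mul_integral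
      (hm u).aestronglyMeasurable (integrable_chainGen hm hi hint k u).aestronglyMeasurable]
    exact mul_le_mul (hE u) (ih u)
      (integral_nonneg fun ω => zero_le_one.trans (one_le_chainGen (fun u => ha u ω) k u))
      (by positivity)

open Classical in
/-- The largest number of vertices with reward above `t` on a chain in `triangle n`. -/
noncomputable def exceedCount (t : ℝ) (w : (Fin 2 → ℕ) → ℝ) (n : ℕ) : ℝ :=
  chainMax (· ≤ ·) (fun v => if t < w v then 1 else 0) n

theorem exceedCount_le (t : ℝ) (w : (Fin 2 → ℕ) → ℝ) (n : ℕ) : exceedCount t w n ≤ n := by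
  classical
  refine chainMax_le fun A h hA => ?_
  refine le_trans (Finset.sum_le_card_nsmul A _ 1 fun v _ => ?_) ?_
  · split_ifs <;> norm_num
  · simpa using card_le_of_isChain h hA

theorem exceedCount_nonneg (t : ℝ) (w : (Fin 2 → ℕ) → ℝ) (n : ℕ) : 0 ≤ exceedCount t w n :=
  chainMax_nonneg

/-- Along an optimal chain the exponential of the count is a product of factors e, one per
exceedance. -/
theorem exp_exceedCount_le (t : ℝ) (w : (Fin 2 → ℕ) → ℝ) (n : ℕ) :
    Real.exp (exceedCount t w n) ≤
      chainGen (fun v => Set.indicator (Set.Ioi t) (fun _ => Real.exp 1) (w v)) n (fun _ => n) := by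
  classical
  obtain ⟨A, h, hA, e⟩ := exists_chain_eq (· ≤ ·) (fun v => if t < w v then (1 : ℝ) else 0) n
  rw [exceedCount, e, ← Finset.sum_filter, Real.exp_sum]
  have hsub : A.filter (fun v => t < w v) ⊆ A := Finset.filter_subset _ _
  have hch : IsChain (· ≤ ·) (A.filter (fun v => t < w v) : Set (Fin 2 → ℕ)) :=
    hA.mono (by exact_mod_cast hsub)
  have := prod_le_chainGen
    (a := fun v => Set.indicator (Set.Ioi t) (fun _ => Real.exp 1) (w v))
    (fun v => Set.indicator_nonneg (fun _ _ => (Real.exp_pos 1).le) _) n (fun _ => n)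
    (A.filter (fun v => t < w v)) (card_le_of_isChain (hsub.trans h) hch) hch
    (fun u hu => by
      have := mem_triangle.1 (h (hsub hu))
      refine Pi.lt_def.2 ⟨fun i => ?_, 0, by omega⟩
      fin_cases i <;> simp <;> omega)
  refine le_trans (le_of_eq ?_) this
  refine Finset.prod_congr rfl fun v hv => ?_
  rw [Set.indicator_of_mem (Set.mem_Ioi.2 (Finset.mem_filter.1 hv).2)]

theorem measurable_exceedCount (t : ℝ) (n : ℕ) :
    Measurable (fun w : (Fin 2 → ℕ) → ℝ => exceedCount t w n) := by
  classical
  refine (measurable_chainMax (· ≤ ·) n).comp (measurable_pi_lambda _ fun v => ?_)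
  exact Measurable.ite (measurableSet_lt measurable_const (measurable_pi_apply v))
    measurable_const measurable_const

/-- The number of vertices with reward above `t` on a chain is of order `n √p` at most, where `p`
bounds the probability that a given reward exceeds `t`. -/
theorem integral_exceedCount_le {w : (Fin 2 → ℕ) → Ω → ℝ} (hm : ∀ v, Measurable (w v))
    (hi : iIndepFun w P) {t p : ℝ} (hp0 : 0 ≤ p) (hp : ∀ v, P.real {ω | t < w v ω} ≤ p) {n : ℕ}
    (hn : 1 ≤ n) :
    ∫ ω, exceedCount t (fun v => w v ω) n ∂P ≤ 16 * n * √p := by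
  have hmeas : Measurable fun ω => exceedCount t (fun v => w v ω) n :=
    (measurable_exceedCount t n).comp (measurable_pi_lambda _ hm)
  have hnn : ∀ ω, 0 ≤ exceedCount t (fun v => w v ω) n := fun ω => exceedCount_nonneg _ _ _
  have hint : Integrable (fun ω => exceedCount t (fun v => w v ω) n) P :=
    Integrable.of_bound hmeas.aestronglyMeasurable n (ae_of_all _ fun ω => by
      rw [Real.norm_of_nonneg (hnn ω)]; exact exceedCount_le _ _ _)
  -- If p is not small, the trivial bound by `n` suffices.
  by_cases hbig : 1 / 4 < √p
  · calc _ ≤ ∫ ω, (n : ℝ) ∂P := integral_mono hint (integrable_const _)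
          fun ω => exceedCount_le _ _ _
      _ = n := by simp
      _ ≤ _ := by nlinarith [(Nat.cast_nonneg n : (0 : ℝ) ≤ n)]
  rw [not_lt] at hbig
  have hs0 : 0 ≤ 2 * √p := by positivity
  -- Since e ≤ 4, each factor has mean at most e p ≤ s².
  set s := 2 * √p with hs
  have hs1 : s ≤ 1 / 2 := by linarith
  have hpos : 0 < 1 - s := by linarith
  have hφ : Measurable (Set.indicator (Set.Ioi t) (fun _ : ℝ => Real.exp 1)) :=
    measurable_const.indicator measurableSet_Ioi
  have key := integral_chainGen_le
    (a := fun v ω => Set.indicator (Set.Ioi t) (fun _ => Real.exp 1) (w v ω)) (P := P)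
    (fun v => hφ.comp (hm v)) (hi.comp (fun _ => _) fun _ => hφ)
    (fun v => Integrable.of_bound (hφ.comp (hm v)).aestronglyMeasurable (Real.exp 1)
      (ae_of_all _ fun ω => by
        refine (norm_indicator_le_norm_self _ _).trans ?_
        simp [abs_of_pos (Real.exp_pos 1)]))
    (fun v ω => Set.indicator_nonneg (fun _ _ => (Real.exp_pos 1).le) _)
    (one_le_inv_iff₀.2 ⟨hpos, by linarith⟩) (mul_inv_cancel₀ hpos.ne')
    (fun v => by
      have : (fun ω => Set.indicator (Set.Ioi t) (fun _ => Real.exp 1) (w v ω))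
        = Set.indicator {ω | t < w v ω} (fun _ => Real.exp 1) := by
        ext ω; simp [Set.indicator]
      rw [this, integral_indicator_const _ (measurableSet_lt measurable_const (hm v)), hs,
        mul_pow, Real.sq_sqrt hp0, smul_eq_mul]
      have := hp v
      have := Real.exp_one_lt_d9
      have := Real.exp_pos 1
      have : 0 ≤ P.real {ω | t < w v ω} := measureReal_nonneg
      nlinarith)
    n (fun _ => n)
  have hinv : (1 - s)⁻¹ ≤ Real.exp (2 * s) := by
    refine le_trans ?_ (Real.add_one_le_exp _)
    rw [inv_le_iff_one_le_mul₀ hpos]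
    nlinarith
  have hpow : (1 - s)⁻¹ ^ (n + n + 2) ≤ Real.exp (16 * n * √p) := by
    calc (1 - s)⁻¹ ^ (n + n + 2) ≤ (1 - s)⁻¹ ^ (4 * n) :=
          pow_le_pow_right₀ (one_le_inv_iff₀.2 ⟨hpos, by linarith⟩) (by omega)
      _ ≤ Real.exp (2 * s) ^ (4 * n) := pow_le_pow_left₀ (by positivity) hinv _
      _ = _ := by rw [← Real.exp_nat_mul, hs]; congr 1; push_cast; ring
  set c := 16 * n * √p with hc
  have hexpint := integrable_chainGen (P := P)
    (a := fun v ω => Set.indicator (Set.Ioi t) (fun _ => Real.exp 1) (w v ω))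
    (fun v => hφ.comp (hm v)) (hi.comp (fun _ => _) fun _ => hφ)
    (fun v => Integrable.of_bound (hφ.comp (hm v)).aestronglyMeasurable (Real.exp 1)
      (ae_of_all _ fun ω => by
        refine (norm_indicator_le_norm_self _ _).trans ?_
        simp [abs_of_pos (Real.exp_pos 1)])) n (fun _ => n)
  -- In place of Jensen's inequality: x + 1 - c ≤ e^(-c) e^x, and the right side has mean at most 1
  -- for this c.
  have hfin : ∫ ω, (exceedCount t (fun v => w v ω) n + (1 - c)) ∂P ≤
      ∫ ω, Real.exp (-c) * chainGen (fun v => Set.indicator (Set.Ioi t) (fun _ => Real.exp 1)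
        (w v ω)) n (fun _ => n) ∂P := by
    refine integral_mono (hint.add (integrable_const _)) (hexpint.const_mul _) fun ω => ?_
    calc exceedCount t (fun v => w v ω) n + (1 - c)
        ≤ Real.exp (exceedCount t (fun v => w v ω) n - c) := by
          have := Real.add_one_le_exp (exceedCount t (fun v => w v ω) n - c)
          linarith
      _ = Real.exp (-c) * Real.exp (exceedCount t (fun v => w v ω) n) := by
          rw [← Real.exp_add]; congr 1; ring
      _ ≤ _ := mul_le_mul_of_nonneg_left (exp_exceedCount_le _ _ _) (Real.exp_pos _).le
  rw [integral_add hint (integrable_const _), integral_const_mul] at hfin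
  simp only [integral_const, probReal_univ, one_smul] at hfin
  have := mul_le_mul_of_nonneg_left (key.trans hpow) (Real.exp_pos (-c)).le
  rw [← Real.exp_add, neg_add_cancel, Real.exp_zero] at this
  linarith

end Prob

/-! ### Pareto tails and fields of scale 1. -/

theorem paretoMeasure_Ioi {x₀ α : ℝ} (hx₀ : 0 < x₀) (hα : 0 < α) {t : ℝ} (ht : x₀ ≤ t) :
    paretoMeasure x₀ α (Set.Ioi t) = ENNReal.ofReal ((t / x₀) ^ (-α)) := by
  have ht0 : 0 < t := by linarith
  rw [paretoMeasure, withDensity_apply _ measurableSet_Ioi]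
  have e : ∫⁻ x in Set.Ioi t, paretoPDF x₀ α x
      = ∫⁻ x in Set.Ioi t, ENNReal.ofReal (α * x₀ ^ α * x ^ (-(α + 1))) := by
    refine setLIntegral_congr_fun measurableSet_Ioi fun x hx => ?_
    have hx' : t < x := hx
    simp [paretoPDF_of_le (show x₀ ≤ x by linarith)]
  rw [e, ← ofReal_integral_eq_lintegral_ofReal, integral_const_mul,
    integral_Ioi_rpow_of_lt (by linarith) ht0]
  · congr 1
    rw [show -(α + 1) + 1 = -α by ring, Real.div_rpow ht0.le hx₀.le, Real.rpow_neg hx₀.le]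
    field_simp
  · exact (integrableOn_Ioi_rpow_of_lt (by linarith) ht0).const_mul (α * x₀ ^ α)
  · refine (ae_restrict_iff' measurableSet_Ioi).2 (ae_of_all _ fun x hx => ?_)
    have hx' : t < x := hx
    have : 0 < x := by linarith
    simp only [Pi.zero_apply]
    positivity

/-- A field of independent nonnegative rewards with the Pareto distribution of scale `1` and
index `α`. -/
structure IsUnitParetoField {Ω : Type*} [MeasurableSpace Ω] (α : ℝ)
    (w : (Fin 2 → ℕ) → Ω → ℝ) (P : Measure Ω) : Prop where
  meas : ∀ v, Measurable (w v)
  nonneg : ∀ v ω, 0 ≤ w v ω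
  indep : iIndepFun w P
  law : ∀ v, P.map (w v) = paretoMeasure 1 α

namespace IsUnitParetoField
variable {Ω : Type*} [MeasurableSpace Ω] {P : Measure Ω} {α : ℝ} {w : (Fin 2 → ℕ) → Ω → ℝ}

theorem measurable_chainMax (h : IsUnitParetoField α w P)
    (R : (Fin 2 → ℕ) → (Fin 2 → ℕ) → Prop) (n : ℕ) :
    Measurable fun ω => chainMax R (fun v => w v ω) n :=
  (LatticeReward.measurable_chainMax R n).comp (measurable_pi_lambda _ h.meas)

theorem map_eq (h : IsUnitParetoField α w P) :
    P.map (fun ω v => w v ω) = Measure.infinitePi (fun _ => paretoMeasure 1 α) := by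
  rw [h.indep.map_fun_eq_infinitePi_map h.meas]
  simp only [h.law]

theorem tail_eq (h : IsUnitParetoField α w P) (hα : 0 < α) (v : Fin 2 → ℕ) {t : ℝ} (ht : 1 ≤ t) :
    P.real {ω | t < w v ω} = t ^ (-α) := by
  have : P {ω | t < w v ω} = paretoMeasure 1 α (Set.Ioi t) := by
    rw [← h.law v, Measure.map_apply (h.meas v) measurableSet_Ioi]; rfl
  rw [measureReal_def, this, paretoMeasure_Ioi one_pos hα ht, div_one, ENNReal.toReal_ofReal (by positivity)]

variable [IsProbabilityMeasure P]

theorem tail_le (h : IsUnitParetoField α w P) (hα : 0 < α) (v : Fin 2 → ℕ) {t : ℝ} (ht : 0 < t) :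
    P.real {ω | t < w v ω} ≤ t ^ (-α) := by
  rcases le_total 1 t with h1 | h1
  · exact (h.tail_eq hα v h1).le
  · exact measureReal_le_one.trans (Real.one_le_rpow_of_pos_of_le_one_of_nonpos ht h1 (by linarith))

theorem measureReal_le_eq (h : IsUnitParetoField α w P) (hα : 0 < α) (v : Fin 2 → ℕ) (t : ℝ) :
    P.real {ω | w v ω ≤ t} = 1 - (max t 1) ^ (-α) := by
  have hc : ∀ s, P.real {ω | w v ω ≤ s} = 1 - P.real {ω | s < w v ω} := fun s => by
    rw [← probReal_compl_eq_one_sub (measurableSet_lt measurable_const (h.meas v))]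
    congr 1; ext ω; simp
  have h1 : P.real {ω | w v ω ≤ 1} = 0 := by rw [hc, h.tail_eq hα v le_rfl]; simp
  rcases le_total 1 t with ht | ht
  · rw [hc, h.tail_eq hα v ht, max_eq_left ht]
  · rw [max_eq_right ht, Real.one_rpow, sub_self]
    exact le_antisymm (h1 ▸ measureReal_mono fun ω (hω : w v ω ≤ t) => hω.trans ht)
      measureReal_nonneg

theorem measureReal_forall_le (h : IsUnitParetoField α w P) (hα : 0 < α)
    (B : Finset (Fin 2 → ℕ)) (t : ℝ) :
    P.real {ω | ∀ v ∈ B, w v ω ≤ t} = (1 - (max t 1) ^ (-α)) ^ B.card := by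
  have := h.indep.measure_inter_preimage_eq_mul B (sets := fun _ => Set.Iic t)
    (fun _ _ => measurableSet_Iic)
  have e : {ω | ∀ v ∈ B, w v ω ≤ t} = ⋂ v ∈ B, w v ⁻¹' Set.Iic t := by ext; simp
  rw [e, measureReal_def, this, ENNReal.toReal_prod, ← Finset.prod_const]
  exact Finset.prod_congr rfl fun v _ => h.measureReal_le_eq hα v t

theorem measureReal_forall_le_le (h : IsUnitParetoField α w P) (hα : 0 < α)
    (B : Finset (Fin 2 → ℕ)) (t : ℝ) (hB : B.Nonempty) :
    P.real {ω | ∀ v ∈ B, w v ω ≤ t} ≤ Real.exp (-(B.card * t ^ (-α))) := by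
  rw [h.measureReal_forall_le hα]
  rcases le_total 1 t with h1 | h1
  · rw [max_eq_left h1, ← mul_neg, Real.exp_nat_mul]
    refine pow_le_pow_left₀ ?_ (by linarith [Real.add_one_le_exp (-t ^ (-α))]) _
    have := Real.rpow_le_one_of_one_le_of_nonpos h1 (by linarith : -α ≤ 0)
    linarith
  · rw [max_eq_right h1, Real.one_rpow, sub_self, zero_pow hB.card_pos.ne']
    positivity

end IsUnitParetoField

/-! ### The contribution of small rewards. -/

open Classical in
/-- The maximal weight of a chain in `triangle n` when rewards above `b` are discarded. -/
noncomputable def truncMax (b : ℝ) (w : (Fin 2 → ℕ) → ℝ) (n : ℕ) : ℝ :=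
  chainMax (· ≤ ·) (fun v => if w v ≤ b then w v else 0) n

theorem truncMax_nonneg (b : ℝ) (w : (Fin 2 → ℕ) → ℝ) (n : ℕ) : 0 ≤ truncMax b w n :=
  chainMax_nonneg

-- A value in (b/2^(j+1), b/2^j] is paid for by the term `j`; values below all levels by the
-- remainder b/2^J.
open Classical in
theorem trunc_le_dyadic {b : ℝ} (hb : 0 ≤ b) (x : ℝ) (J : ℕ) :
    (if x ≤ b then x else 0) ≤
      ∑ j ∈ Finset.range J, b / 2 ^ j * (if b / 2 ^ (j + 1) < x then 1 else 0) + b / 2 ^ J := by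
  induction J with
  | zero =>
    simp only [Finset.range_zero, Finset.sum_empty, zero_add, pow_zero, div_one]
    split_ifs <;> assumption
  | succ J ih =>
    rw [Finset.sum_range_succ]
    by_cases h : b / 2 ^ (J + 1) < x
    · have : 0 ≤ b / 2 ^ (J + 1) := by positivity
      simp only [h, if_true]
      linarith
    · have h0 : 0 ≤ ∑ j ∈ Finset.range J, b / 2 ^ j * (if b / 2 ^ (j + 1) < x then (1 : ℝ) else 0) :=
        Finset.sum_nonneg fun j _ => by positivity
      have h1 : 0 ≤ b / 2 ^ (J + 1) := by positivity
      simp only [h, if_false, mul_zero, add_zero]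
      split_ifs <;> linarith

theorem truncMax_le_dyadic {b : ℝ} (hb : 0 ≤ b) (w : (Fin 2 → ℕ) → ℝ) (n J : ℕ) :
    truncMax b w n ≤
      ∑ j ∈ Finset.range J, b / 2 ^ j * exceedCount (b / 2 ^ (j + 1)) w n + n * (b / 2 ^ J) := by
  classical
  refine chainMax_le fun A h hA => ?_
  refine (Finset.sum_le_sum fun v _ => trunc_le_dyadic hb (w v) J).trans ?_
  rw [Finset.sum_add_distrib, Finset.sum_comm]
  refine add_le_add (Finset.sum_le_sum fun j _ => ?_) ?_
  · rw [← Finset.mul_sum]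
    exact mul_le_mul_of_nonneg_left (sum_le_chainMax h hA) (by positivity)
  · rw [Finset.sum_const, nsmul_eq_mul]
    have : (A.card : ℝ) ≤ n := by exact_mod_cast card_le_of_isChain h hA
    exact mul_le_mul_of_nonneg_right this (by positivity)

theorem measurable_truncMax (b : ℝ) (n : ℕ) :
    Measurable (fun w : (Fin 2 → ℕ) → ℝ => truncMax b w n) := by
  classical
  refine (measurable_chainMax (· ≤ ·) n).comp (measurable_pi_lambda _ fun v => ?_)
  exact Measurable.ite (measurableSet_le (measurable_pi_apply v) measurable_const)
    (measurable_pi_apply v) measurable_const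

/-- The constant in the bound for the contribution of small rewards. -/
noncomputable def truncConst (α : ℝ) : ℝ := 32 / (1 - (1 / 2) ^ (1 - α / 2))

theorem half_rpow_lt_one {α : ℝ} (hα : α < 2) : (1 / 2 : ℝ) ^ (1 - α / 2) < 1 :=
  Real.rpow_lt_one (by norm_num) (by norm_num) (by linarith)

theorem truncConst_pos {α : ℝ} (hα : α < 2) : 0 < truncConst α :=
  div_pos (by norm_num) (by linarith [half_rpow_lt_one hα])

theorem IsUnitParetoField.integrable_truncMax {Ω : Type*} [MeasurableSpace Ω] {P : Measure Ω}
    [IsProbabilityMeasure P] {α : ℝ} {w : (Fin 2 → ℕ) → Ω → ℝ} (h : IsUnitParetoField α w P)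
    {b : ℝ} (hb : 0 ≤ b) (n : ℕ) :
    Integrable (fun ω => truncMax b (fun v => w v ω) n) P := by
  refine Integrable.of_bound
    ((measurable_truncMax b n).comp (measurable_pi_lambda _ h.meas)).aestronglyMeasurable (n * b)
    (ae_of_all _ fun ω => ?_)
  rw [Real.norm_of_nonneg (truncMax_nonneg _ _ _)]
  -- With no dyadic level the bound is `n * b`.
  simpa using truncMax_le_dyadic hb (fun v => w v ω) n 0

/-- Level `j` costs b/2^j times a count of order n (b/2^(j+1))^(-α/2). These terms are geometric
with ratio 2^(-(1-α/2)), below 1 exactly because α < 2. The remainder vanishes as `J` grows. -/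
theorem IsUnitParetoField.integral_truncMax_le {Ω : Type*} [MeasurableSpace Ω] {P : Measure Ω}
    [IsProbabilityMeasure P] {α : ℝ} {w : (Fin 2 → ℕ) → Ω → ℝ} (h : IsUnitParetoField α w P)
    (hα0 : 0 < α) (hα2 : α < 2) {b : ℝ} (hb : 0 < b) {n : ℕ} (hn : 1 ≤ n) :
    ∫ ω, truncMax b (fun v => w v ω) n ∂P ≤ truncConst α * n * b ^ (1 - α / 2) := by
  set γ := 1 - α / 2 with hγ
  set ρ : ℝ := (1 / 2) ^ γ with hρ
  have hρ1 : ρ < 1 := half_rpow_lt_one hα2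
  have hρ0 : 0 < ρ := by positivity
  have hint : ∀ t, Integrable (fun ω => exceedCount t (fun v => w v ω) n) P := fun t =>
    Integrable.of_bound
      ((measurable_exceedCount t n).comp (measurable_pi_lambda _ h.meas)).aestronglyMeasurable n
      (ae_of_all _ fun ω => by
        rw [Real.norm_of_nonneg (exceedCount_nonneg _ _ _)]; exact exceedCount_le _ _ _)
  have hterm : ∀ j : ℕ, b / 2 ^ j * ∫ ω, exceedCount (b / 2 ^ (j + 1)) (fun v => w v ω) n ∂P ≤
      32 * n * b ^ γ * ρ ^ j := by
    intro j
    have ht : 0 < b / 2 ^ (j + 1) := by positivity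
    have h1 := integral_exceedCount_le h.meas h.indep (by positivity)
      (fun v => h.tail_le hα0 v ht) hn
    have h2 : √((b / 2 ^ (j + 1)) ^ (-α)) = (b / 2 ^ (j + 1)) ^ (-(α / 2)) := by
      rw [Real.sqrt_eq_rpow, ← Real.rpow_mul ht.le]; congr 1; ring
    have h3 : (b / 2 ^ (j + 1)) * (b / 2 ^ (j + 1)) ^ (-(α / 2)) = b ^ γ * ρ ^ (j + 1) := by
      rw [← Real.rpow_one_add' ht.le (by linarith), show 1 + -(α / 2) = γ by rw [hγ]; ring, hρ,
        ← Real.rpow_mul_natCast (by norm_num), mul_comm γ, Real.rpow_natCast_mul (by norm_num),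
        ← Real.mul_rpow hb.le (by positivity)]
      congr 1
      rw [one_div, inv_pow]; rfl
    calc b / 2 ^ j * ∫ ω, exceedCount (b / 2 ^ (j + 1)) (fun v => w v ω) n ∂P
        ≤ b / 2 ^ j * (16 * n * √((b / 2 ^ (j + 1)) ^ (-α))) :=
          mul_le_mul_of_nonneg_left h1 (by positivity)
      -- The constant doubles because b/2^j is twice the threshold b/2^(j+1).
      _ = 32 * n * ((b / 2 ^ (j + 1)) * (b / 2 ^ (j + 1)) ^ (-(α / 2))) := by
          rw [h2, pow_succ]; field_simp; ring
      _ = 32 * n * b ^ γ * (ρ ^ j * ρ) := by rw [h3, pow_succ]; ring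
      _ ≤ 32 * n * b ^ γ * ρ ^ j := by
          refine mul_le_mul_of_nonneg_left ?_ (by positivity)
          exact mul_le_of_le_one_right (by positivity) hρ1.le
  have hJ : ∀ J : ℕ, ∫ ω, truncMax b (fun v => w v ω) n ∂P ≤
      truncConst α * n * b ^ γ + n * (b / 2 ^ J) := by
    intro J
    calc ∫ ω, truncMax b (fun v => w v ω) n ∂P
        ≤ ∫ ω, (∑ j ∈ Finset.range J, b / 2 ^ j * exceedCount (b / 2 ^ (j + 1)) (fun v => w v ω) n
            + n * (b / 2 ^ J)) ∂P :=
          integral_mono (h.integrable_truncMax hb.le n)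
            ((integrable_finsetSum _ fun j _ => (hint _).const_mul _).add (integrable_const _))
            fun ω => truncMax_le_dyadic hb.le _ n J
      _ = ∑ j ∈ Finset.range J,
            b / 2 ^ j * ∫ ω, exceedCount (b / 2 ^ (j + 1)) (fun v => w v ω) n ∂P
            + n * (b / 2 ^ J) := by
          rw [integral_add (integrable_finsetSum _ fun j _ => (hint _).const_mul _)
            (integrable_const _), integral_finsetSum _ fun j _ => (hint _).const_mul _]
          simp [integral_const_mul]
      _ ≤ ∑ j ∈ Finset.range J, 32 * n * b ^ γ * ρ ^ j + n * (b / 2 ^ J) :=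
          add_le_add (Finset.sum_le_sum fun j _ => hterm j) le_rfl
      _ ≤ _ := by
          refine add_le_add ?_ le_rfl
          rw [← Finset.mul_sum]
          have hg : ∑ j ∈ Finset.range J, ρ ^ j ≤ (1 - ρ)⁻¹ :=
            (summable_geometric_of_lt_one hρ0.le hρ1).sum_le_tsum _ (fun _ _ => by positivity)
              |>.trans_eq (tsum_geometric_of_lt_one hρ0.le hρ1)
          calc 32 * n * b ^ γ * ∑ j ∈ Finset.range J, ρ ^ j ≤ 32 * n * b ^ γ * (1 - ρ)⁻¹ :=
                mul_le_mul_of_nonneg_left hg (by positivity)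
            _ = _ := by rw [truncConst]; ring
  have hlim : Tendsto (fun J : ℕ => truncConst α * n * b ^ γ + n * (b / 2 ^ J)) atTop
      (𝓝 (truncConst α * n * b ^ γ + n * 0)) := by
    refine tendsto_const_nhds.add (Tendsto.const_mul _ ?_)
    exact tendsto_const_nhds.div_atTop (tendsto_pow_atTop_atTop_of_one_lt (by norm_num))
  simpa using ge_of_tendsto' hlim hJ


/-! ### Bounds at the scale n^(2/α), uniform in n. -/

theorem scaled_rpow_neg {α : ℝ} (hα : 0 < α) {δ : ℝ} (hδ : 0 < δ) (n : ℕ) :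
    (δ * (n : ℝ) ^ (2 / α)) ^ (-α) = δ ^ (-α) * ((n : ℝ) ^ 2)⁻¹ := by
  rw [Real.mul_rpow hδ.le (by positivity), ← Real.rpow_mul (by positivity),
    show 2 / α * -α = -((2 : ℕ) : ℝ) by field_simp; norm_num, Real.rpow_neg (by positivity) (2 : ℕ),
    Real.rpow_natCast]

theorem mul_scaled_rpow {α : ℝ} (hα : 0 < α) {δ : ℝ} (hδ : 0 < δ) {n : ℕ} (hn : 1 ≤ n) :
    n * (δ * (n : ℝ) ^ (2 / α)) ^ (1 - α / 2) = δ ^ (1 - α / 2) * (n : ℝ) ^ (2 / α) := by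
  have hn0 : (0 : ℝ) < n := by exact_mod_cast hn
  rw [Real.mul_rpow hδ.le (by positivity), ← Real.rpow_mul (by positivity),
    show 2 / α * (1 - α / 2) = 2 / α - 1 by field_simp, Real.rpow_sub_one hn0.ne']
  field_simp

theorem card_triangle_le (n : ℕ) : (triangle n).card ≤ n ^ 2 := by
  have : triangle n ⊆ Fintype.piFinset (fun _ : Fin 2 => Finset.range n) := fun v hv => by
    have := mem_triangle.1 hv
    simp only [Fintype.mem_piFinset, Finset.mem_range, Fin.forall_fin_two]
    omega
  simpa using Finset.card_le_card this

theorem chainMax_le_add_truncMax {w : (Fin 2 → ℕ) → ℝ} {b : ℝ} {n : ℕ}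
    {x : ℝ} (h : ∀ A ⊆ triangle n, IsChain (· ≤ ·) (A : Set (Fin 2 → ℕ)) → (∀ v ∈ A, b < w v) →
      ∑ v ∈ A, w v ≤ x) :
    chainMax (· ≤ ·) w n ≤ x + truncMax b w n := by
  classical
  refine chainMax_le fun A hA hc => ?_
  rw [← Finset.sum_filter_add_sum_filter_not A (fun v => b < w v)]
  have hsub : A.filter (fun v => b < w v) ⊆ A := Finset.filter_subset _ _
  refine add_le_add (h _ (hsub.trans hA) (hc.mono (by exact_mod_cast hsub))
    fun v hv => (Finset.mem_filter.1 hv).2) ?_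
  simp only [not_lt]
  rw [Finset.sum_filter]
  exact sum_le_chainMax hA hc

namespace IsUnitParetoField
variable {Ω : Type*} [MeasurableSpace Ω] {P : Measure Ω} [IsProbabilityMeasure P]
  {α : ℝ} {w : (Fin 2 → ℕ) → Ω → ℝ}

theorem scaled_tail_le (h : IsUnitParetoField α w P) (hα : 0 < α) (v : Fin 2 → ℕ) {δ : ℝ}
    (hδ : 0 < δ) {n : ℕ} (hn : 1 ≤ n) :
    P.real {ω | δ * (n : ℝ) ^ (2 / α) < w v ω} ≤ δ ^ (-α) * ((n : ℝ) ^ 2)⁻¹ := by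
  have hn0 : (0 : ℝ) < n := by exact_mod_cast hn
  rw [← scaled_rpow_neg hα hδ]
  exact h.tail_le hα v (by positivity)

/-- The rewards below `δ n^(2/α)` contribute little, uniformly in `n`. -/
theorem measureReal_truncMax_ge_le (h : IsUnitParetoField α w P) (hα0 : 0 < α) (hα2 : α < 2)
    {δ η : ℝ} (hδ : 0 < δ) (hη : 0 < η) {n : ℕ} (hn : 1 ≤ n) :
    P.real {ω | η * (n : ℝ) ^ (2 / α) ≤ truncMax (δ * (n : ℝ) ^ (2 / α)) (fun v => w v ω) n} ≤
      truncConst α * δ ^ (1 - α / 2) / η := by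
  have hn0 : (0 : ℝ) < n := by exact_mod_cast hn
  have hN : 0 < (n : ℝ) ^ (2 / α) := by positivity
  have hb : 0 < δ * (n : ℝ) ^ (2 / α) := by positivity
  have h1 := mul_meas_ge_le_integral_of_nonneg (μ := P)
    (ae_of_all _ fun ω => truncMax_nonneg (δ * (n : ℝ) ^ (2 / α)) (fun v => w v ω) n)
    (h.integrable_truncMax hb.le n) (η * (n : ℝ) ^ (2 / α))
  have h2 := h1.trans (h.integral_truncMax_le hα0 hα2 hb hn)
  rw [mul_assoc (truncConst α), mul_scaled_rpow hα0 hδ hn] at h2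
  rw [le_div_iff₀ hη]
  refine le_of_mul_le_mul_right ?_ hN
  linarith

/-- Either some reward exceeds δ n^(2/α), which a union bound over at most n² vertices controls, or
the whole chain consists of small rewards. -/
theorem measureReal_chainMax_gt_le (h : IsUnitParetoField α w P) (hα0 : 0 < α) (hα2 : α < 2)
    {δ C : ℝ} (hδ : 0 < δ) (hC : 0 < C) {n : ℕ} (hn : 1 ≤ n) :
    P.real {ω | C * (n : ℝ) ^ (2 / α) < chainMax (· ≤ ·) (fun v => w v ω) n} ≤
      δ ^ (-α) + truncConst α * δ ^ (1 - α / 2) / C := by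
  have hn0 : (0 : ℝ) < n := by exact_mod_cast hn
  have hsub : {ω | C * (n : ℝ) ^ (2 / α) < chainMax (· ≤ ·) (fun v => w v ω) n} ⊆
      (⋃ v ∈ triangle n, {ω | δ * (n : ℝ) ^ (2 / α) < w v ω}) ∪
      {ω | C * (n : ℝ) ^ (2 / α) ≤ truncMax (δ * (n : ℝ) ^ (2 / α)) (fun v => w v ω) n} := by
    intro ω hω
    by_contra hnot
    simp only [Set.mem_union, Set.mem_iUnion, Set.mem_ofPred_eq, not_or, not_exists, not_lt,
      not_le] at hnot hω
    have := chainMax_le_add_truncMax (w := fun v => w v ω) (b := δ * (n : ℝ) ^ (2 / α)) (n := n)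
      (x := 0) (fun A hA _ hbig => by
        have : A = ∅ := Finset.eq_empty_of_forall_notMem fun v hv =>
          absurd (hbig v hv) (not_lt.2 (hnot.1 v (hA hv)))
        simp [this])
    linarith [hnot.2]
  refine (measureReal_mono hsub).trans ((measureReal_union_le _ _).trans
    (add_le_add ?_ (h.measureReal_truncMax_ge_le hα0 hα2 hδ hC hn)))
  calc P.real (⋃ v ∈ triangle n, {ω | δ * (n : ℝ) ^ (2 / α) < w v ω})
      ≤ ∑ v ∈ triangle n, P.real {ω | δ * (n : ℝ) ^ (2 / α) < w v ω} :=
        measureReal_biUnion_finset_le _ _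
    _ ≤ ∑ v ∈ triangle n, δ ^ (-α) * ((n : ℝ) ^ 2)⁻¹ :=
        Finset.sum_le_sum fun v _ => h.scaled_tail_le hα0 v hδ hn
    _ ≤ (n : ℝ) ^ 2 * (δ ^ (-α) * ((n : ℝ) ^ 2)⁻¹) := by
        rw [Finset.sum_const, nsmul_eq_mul]
        refine mul_le_mul_of_nonneg_right ?_ (by positivity)
        exact_mod_cast card_triangle_le n
    _ = δ ^ (-α) := by field_simp

theorem measureReal_chainMax_le_le (h : IsUnitParetoField α w P) (hα0 : 0 < α)
    {c : ℝ} (hc : 0 < c) {n : ℕ} (hn : 1 ≤ n) :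
    P.real {ω | chainMax (· ≤ ·) (fun v => w v ω) n ≤ c * (n : ℝ) ^ (2 / α)} ≤
      Real.exp (-(c ^ (-α) / 4)) := by
  have hn0 : (0 : ℝ) < n := by exact_mod_cast hn
  -- A square of side ⌈n/2⌉ fits in the triangle and has at least n²/4 vertices; all their rewards
  -- would have to be small.
  set B : Finset (Fin 2 → ℕ) := Fintype.piFinset fun _ => Finset.range ((n + 1) / 2) with hB
  have hcard : B.card = ((n + 1) / 2) ^ 2 := by simp [hB]
  have hBsub : B ⊆ triangle n := fun v hv => by
    simp only [hB, Fintype.mem_piFinset, Finset.mem_range, Fin.forall_fin_two] at hv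
    rw [mem_triangle]
    omega
  have hne : B.Nonempty := Finset.card_pos.1 (by
    rw [hcard]
    have : 0 < (n + 1) / 2 := by omega
    positivity)
  refine (measureReal_mono fun ω
      (hω : chainMax (· ≤ ·) (fun v => w v ω) n ≤ c * (n : ℝ) ^ (2 / α)) => ?_).trans
    ((h.measureReal_forall_le_le hα0 B (c * (n : ℝ) ^ (2 / α)) hne).trans
      (Real.exp_le_exp.2 (neg_le_neg ?_)))
  · exact fun v hv => (le_chainMax (w := fun v => w v ω) (hBsub hv)).trans hω
  · rw [scaled_rpow_neg hα0 hc, hcard]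
    have : (n : ℝ) ≤ 2 * ((n + 1) / 2 : ℕ) := by
      have : n ≤ 2 * ((n + 1) / 2) := by omega
      exact_mod_cast this
    have h4 : (n : ℝ) ^ 2 ≤ 4 * (((n + 1) / 2 : ℕ) : ℝ) ^ 2 := by nlinarith
    have hcp : 0 < c ^ (-α) := by positivity
    push_cast
    rw [div_le_iff₀ (by norm_num)]
    calc c ^ (-α) = (n : ℝ) ^ 2 * (c ^ (-α) * ((n : ℝ) ^ 2)⁻¹) := by field_simp
      _ ≤ _ * (c ^ (-α) * ((n : ℝ) ^ 2)⁻¹) := mul_le_mul_of_nonneg_right h4 (by positivity)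
      _ = _ := by ring

end IsUnitParetoField

/-! ### Coarse graining into squares. -/

/-- The index of the square of side `q` that contains `v`. -/
def cell (q : ℕ) (v : Fin 2 → ℕ) : Fin 2 → ℕ := fun i => v i / q

/-- The square of side `q` with index `c`. -/
def box (q : ℕ) (c : Fin 2 → ℕ) : Finset (Fin 2 → ℕ) :=
  Fintype.piFinset fun i => Finset.Ico (q * c i) (q * c i + q)

theorem mem_box {q : ℕ} (hq : 0 < q) {c v : Fin 2 → ℕ} : v ∈ box q c ↔ cell q v = c := by
  simp only [box, Fintype.mem_piFinset, Finset.mem_Ico, funext_iff, cell]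
  refine forall_congr' fun i => ?_
  rw [Nat.div_eq_iff hq, mul_comm q]
  omega

theorem card_box (q : ℕ) (c : Fin 2 → ℕ) : (box q c).card = q ^ 2 := by
  simp [box, sq]

/-- The largest value of `w` on the square of side `q` with index `c`. -/
noncomputable def boxMax (q : ℕ) (w : (Fin 2 → ℕ) → ℝ) (c : Fin 2 → ℕ) : ℝ :=
  -- The corner belongs to the square when `q` is positive; inserting it keeps the set nonempty for
  -- `q = 0`.
  (insert (q • c) (box q c)).sup' (Finset.insert_nonempty _ _) w

theorem insert_box {q : ℕ} (hq : 0 < q) (c : Fin 2 → ℕ) : insert (q • c) (box q c) = box q c :=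
  Finset.insert_eq_self.2 (by simp [box, hq])

theorem le_boxMax {q : ℕ} (hq : 0 < q) (w : (Fin 2 → ℕ) → ℝ) (v : Fin 2 → ℕ) :
    w v ≤ boxMax q w (cell q v) :=
  Finset.le_sup' w (Finset.mem_insert_of_mem ((mem_box hq).2 rfl))

theorem exists_boxMax_eq {q : ℕ} (hq : 0 < q) (w : (Fin 2 → ℕ) → ℝ) (c : Fin 2 → ℕ) :
    ∃ v, cell q v = c ∧ boxMax q w c = w v := by
  obtain ⟨v, hv, e⟩ := Finset.exists_mem_eq_sup' (Finset.insert_nonempty (q • c) (box q c)) w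
  rw [insert_box hq] at hv
  exact ⟨v, (mem_box hq).1 hv, e⟩

theorem boxMax_le_iff {q : ℕ} (hq : 0 < q) {w : (Fin 2 → ℕ) → ℝ} {c : Fin 2 → ℕ} {y : ℝ} :
    boxMax q w c ≤ y ↔ ∀ v ∈ box q c, w v ≤ y := by
  rw [boxMax, Finset.sup'_le_iff, insert_box hq]

theorem continuous_boxMax (q : ℕ) (c : Fin 2 → ℕ) :
    Continuous fun w : (Fin 2 → ℕ) → ℝ => boxMax q w c :=
  Continuous.finset_sup'_apply _ fun v _ => continuous_apply v

/-- Chains of squares can be realised by chains of vertices. -/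
theorem chainMax_boxMax_le {q : ℕ} (hq : 0 < q) (w : (Fin 2 → ℕ) → ℝ) {K n : ℕ} (hn : K * q ≤ n) :
    chainMax StrongLT (boxMax q w) (K - 1) ≤ chainMax (· ≤ ·) w n := by
  classical
  refine chainMax_le fun A hA hc => ?_
  choose f hf e using exists_boxMax_eq hq w
  have hinj : Function.Injective f := fun c d h => by rw [← hf c, ← hf d, h]
  rw [Finset.sum_congr rfl fun c _ => e c, ← Finset.sum_image (f := w) fun c _ d _ h => hinj h]
  -- Squares strictly ordered in both coordinates have comparable vertices, whichever
  -- representatives attain the maxima.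
  have hlt : ∀ c d : Fin 2 → ℕ, StrongLT c d → f c ≤ f d := fun c d h i => by
    have h1 := h i
    rw [← hf c, ← hf d] at h1
    by_contra hlt
    exact absurd (Nat.div_le_div_right (c := q) (not_le.1 hlt).le) (not_le.2 h1)
  refine sum_le_chainMax (fun v hv => ?_) ?_
  · obtain ⟨c, hcA, rfl⟩ := Finset.mem_image.1 hv
    have h1 := mem_triangle.1 (hA hcA)
    have h2 : ∀ i, f c i < (c i + 1) * q := fun i => by
      have h3 : f c i / q = c i := congrFun (hf c) i
      rw [← h3, add_mul, one_mul]
      exact Nat.lt_div_mul_add hq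
    -- The size `K - 1` of the triangle of squares gives c₀ + c₁ + 2 ≤ K, so each such square lies
    -- entirely in the triangle of vertices.
    have h3 : (c 0 + 1 + (c 1 + 1)) * q ≤ K * q := Nat.mul_le_mul_right _ (by omega)
    have := h2 0
    have := h2 1
    rw [mem_triangle]
    rw [add_mul] at h3
    omega
  · rw [Finset.coe_image]
    rintro _ ⟨c, hcA, rfl⟩ _ ⟨d, hd, rfl⟩ hne
    rcases hc hcA hd (fun h => hne (h ▸ rfl)) with h | h
    · exact Or.inl (hlt c d h)
    · exact Or.inr (hlt d c h)

/-- The rewards above `b` are well separated relative to the squares of side `q`: no two of them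
are in the same row or column of squares, and all are in squares inside the triangle. -/
def Separated (b : ℝ) (w : (Fin 2 → ℕ) → ℝ) (K n q : ℕ) : Prop :=
  (∀ u ∈ triangle n, ∀ v ∈ triangle n, u ≠ v → (∃ i, u i / q = v i / q) → ¬ (b < w u ∧ b < w v)) ∧
  ∀ v ∈ triangle n, b < w v → cell q v ∈ triangle (K - 1)

/-- Separation sends the large rewards of a chain to distinct squares that increase strictly in both
coordinates; each reward is at most the maximum of its square. -/
theorem chainMax_le_of_separated {b : ℝ} {w : (Fin 2 → ℕ) → ℝ} {K n q : ℕ} (hq : 0 < q)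
    (hs : Separated b w K n q) :
    chainMax (· ≤ ·) w n ≤ chainMax StrongLT (boxMax q w) (K - 1) + truncMax b w n := by
  classical
  refine chainMax_le_add_truncMax (b := b) fun A hA hc hbig => ?_
  have hlt : ∀ u ∈ A, ∀ v ∈ A, u ≠ v → u ≤ v → StrongLT (cell q u) (cell q v) := by
    intro u hu v hv hne hle i
    refine lt_of_le_of_ne (Nat.div_le_div_right (hle i)) fun h => ?_
    exact hs.1 u (hA hu) v (hA hv) hne ⟨i, h⟩ ⟨hbig u hu, hbig v hv⟩
  have hinj : Set.InjOn (cell q) A := by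
    intro u hu v hv h
    by_contra hne
    exact hs.1 u (hA hu) v (hA hv) hne ⟨0, congrFun h 0⟩ ⟨hbig u hu, hbig v hv⟩
  calc ∑ v ∈ A, w v ≤ ∑ v ∈ A, boxMax q w (cell q v) :=
        Finset.sum_le_sum fun v _ => le_boxMax hq w v
    _ = ∑ c ∈ A.image (cell q), boxMax q w c := (Finset.sum_image hinj).symm
    _ ≤ _ := by
      refine sum_le_chainMax (fun c hc => ?_) ?_
      · obtain ⟨v, hv, rfl⟩ := Finset.mem_image.1 hc
        exact hs.2 v (hA hv) (hbig v hv)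
      · rw [Finset.coe_image]
        rintro _ ⟨u, hu, rfl⟩ _ ⟨v, hv, rfl⟩ hne
        have hne' : u ≠ v := fun h => hne (h ▸ rfl)
        rcases hc hu hv hne' with h | h
        · exact Or.inl (hlt u hu v hv hne' h)
        · exact Or.inr (hlt v hv u hu hne'.symm h)


theorem card_filter_same_row_le {n q : ℕ} (hq : 0 < q) (u : Fin 2 → ℕ) :
    ((triangle n).filter (fun v => u ≠ v ∧ ∃ i, u i / q = v i / q)).card ≤ 2 * (q * n) := by
  classical
  set I : Fin 2 → Finset ℕ := fun i => Finset.Ico (q * (u i / q)) (q * (u i / q) + q) with hI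
  have hmem : ∀ i, ∀ v : Fin 2 → ℕ, u i / q = v i / q → v i ∈ I i := fun i v h => by
    simp only [hI, h, Finset.mem_Ico]
    have := Nat.div_mul_le_self (v i) q
    have := Nat.lt_div_mul_add (a := v i) hq
    rw [mul_comm q]
    omega
  have hsub : (triangle n).filter (fun v => u ≠ v ∧ ∃ i, u i / q = v i / q) ⊆
      Fintype.piFinset ![I 0, Finset.range n] ∪ Fintype.piFinset ![Finset.range n, I 1] := by
    intro v hv
    obtain ⟨hv1, -, i, hi⟩ := Finset.mem_filter.1 hv
    rw [mem_triangle] at hv1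
    have := hmem i v hi
    simp only [Finset.mem_union, Fintype.mem_piFinset, Fin.forall_fin_two]
    fin_cases i
    · exact Or.inl ⟨this, Finset.mem_range.2 (by omega)⟩
    · exact Or.inr ⟨Finset.mem_range.2 (by omega), this⟩
  refine (Finset.card_le_card hsub).trans ((Finset.card_union_le _ _).trans (le_of_eq ?_))
  simp [Fintype.card_piFinset, Fin.prod_univ_two, hI]
  ring

/-- Vertices whose square is not indexed by the smaller triangle lie in the band (K-1)q ≤ v₀ + v₁ <
n with q = n/K. Its width is at most q + K ≤ 2q, the last step because K² ≤ n. -/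
theorem card_filter_cell_le {n K : ℕ} (hK : 0 < K) (hn : K ^ 2 ≤ n) :
    ((triangle n).filter (fun v => cell (n / K) v ∉ triangle (K - 1))).card
      ≤ 2 * (n / K * n) := by
  classical
  set q := n / K with hq
  have hqK : K ≤ q := (Nat.le_div_iff_mul_le hK).2 (by rwa [← sq])
  have hlt : n < q * K + K := Nat.lt_div_mul_add hK
  calc _ ≤ (Finset.range n ×ˢ Finset.Ico ((K - 1) * q) n).card := by
        refine Finset.card_le_card_of_injOn (fun v => (v 0, v 0 + v 1)) (fun v hv => ?_) ?_
        · obtain ⟨h1, h2⟩ := Finset.mem_filter.1 (Finset.mem_coe.1 hv)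
          rw [mem_triangle] at h1 h2
          have h3 : (K - 1) * q ≤ (v 0 / q + v 1 / q) * q :=
            Nat.mul_le_mul_right _ (not_lt.1 h2)
          rw [add_mul] at h3
          have := Nat.div_mul_le_self (v 0) q
          have := Nat.div_mul_le_self (v 1) q
          simp only [Finset.coe_product, Set.mem_prod, Finset.mem_coe, Finset.mem_range,
            Finset.mem_Ico]
          omega
        · intro u _ v _ h
          simp only [Prod.mk.injEq] at h
          ext i
          fin_cases i <;> simp <;> omega
    _ = n * (n - (K - 1) * q) := by simp
    _ ≤ n * (2 * q) := by
        refine Nat.mul_le_mul_left _ ?_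
        have : (K - 1) * q + q = q * K := by
          obtain ⟨k, rfl⟩ : ∃ k, K = k + 1 := ⟨K - 1, by omega⟩
          simp; ring
        omega
    _ = _ := by ring

section Prob
variable {Ω : Type*} [MeasurableSpace Ω] {P : Measure Ω} {α : ℝ} {w : (Fin 2 → ℕ) → Ω → ℝ}

/-- A union bound: at most n² · 2n²/K pairs share a row or column of squares, each doubly large with
probability at most p², and at most 2n²/K vertices are near the boundary, each large with
probability at most p, where p = δ^(-α)/n². -/
theorem IsUnitParetoField.measureReal_not_separated_le [IsProbabilityMeasure P]
    (h : IsUnitParetoField α w P) (hα : 0 < α) {δ : ℝ} (hδ : 0 < δ) {n K : ℕ} (hK : 0 < K)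
    (hn : K ^ 2 ≤ n) :
    P.real {ω | ¬ Separated (δ * (n : ℝ) ^ (2 / α)) (fun v => w v ω) K n (n / K)} ≤
      2 * (δ ^ (-α) * δ ^ (-α) + δ ^ (-α)) / K := by
  classical
  have hn1 : 1 ≤ n := le_trans (Nat.one_le_pow _ _ hK) hn
  have hn0 : (0 : ℝ) < n := by exact_mod_cast hn1
  have hK0 : (0 : ℝ) < K := by exact_mod_cast hK
  set q := n / K with hq
  have hqK : K ≤ q := (Nat.le_div_iff_mul_le hK).2 (by rwa [← sq])
  have hq0 : 0 < q := hK.trans_le hqK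
  set b := δ * (n : ℝ) ^ (2 / α) with hb
  set p := δ ^ (-α) * ((n : ℝ) ^ 2)⁻¹ with hp
  have hp0 : 0 ≤ p := by positivity
  set S := fun u => (triangle n).filter (fun v => u ≠ v ∧ ∃ i, u i / q = v i / q) with hS
  set D := (triangle n).filter (fun v => cell q v ∉ triangle (K - 1)) with hD
  have hsub : {ω | ¬ Separated b (fun v => w v ω) K n q} ⊆
      (⋃ u ∈ triangle n, ⋃ v ∈ S u, ({ω | b < w u ω} ∩ {ω | b < w v ω})) ∪
      ⋃ v ∈ D, {ω | b < w v ω} := by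
    intro ω hω
    by_contra hnot
    simp only [Set.mem_union, Set.mem_iUnion, not_or, not_exists] at hnot
    refine hω ⟨fun u hu v hv hne hi hbig => ?_, fun v hv hbig => ?_⟩
    · exact hnot.1 u hu v (Finset.mem_filter.2 ⟨hv, hne, hi⟩) hbig
    · by_contra hc
      exact hnot.2 v (Finset.mem_filter.2 ⟨hv, hc⟩) hbig
  have htail : ∀ v, P.real {ω | b < w v ω} ≤ p := fun v => h.scaled_tail_le hα v hδ hn1
  have hpair : ∀ u, ∀ v ∈ S u, P.real ({ω | b < w u ω} ∩ {ω | b < w v ω}) ≤ p * p := by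
    intro u v hv
    have := (h.indep.indepFun (Finset.mem_filter.1 hv).2.1).measure_inter_preimage_eq_mul
      (Set.Ioi b) (Set.Ioi b) measurableSet_Ioi measurableSet_Ioi
    have e : P.real ({ω | b < w u ω} ∩ {ω | b < w v ω})
        = P.real {ω | b < w u ω} * P.real {ω | b < w v ω} := by
      rw [measureReal_def, measureReal_def, measureReal_def, ← ENNReal.toReal_mul]
      exact congrArg _ this
    rw [e]
    exact mul_le_mul (htail u) (htail v) measureReal_nonneg hp0
  have hqn : ((q * n : ℕ) : ℝ) ≤ (n : ℝ) ^ 2 / K := by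
    rw [le_div_iff₀ hK0]
    have : q * n * K ≤ n ^ 2 := by
      calc q * n * K = q * K * n := by ring
        _ ≤ n * n := Nat.mul_le_mul_right _ (Nat.div_mul_le_self n K)
        _ = n ^ 2 := by ring
    exact_mod_cast this
  have h1 : P.real (⋃ u ∈ triangle n, ⋃ v ∈ S u, ({ω | b < w u ω} ∩ {ω | b < w v ω})) ≤
      (n : ℝ) ^ 2 * (2 * ((n : ℝ) ^ 2 / K) * (p * p)) := by
    calc _ ≤ ∑ u ∈ triangle n, P.real (⋃ v ∈ S u, ({ω | b < w u ω} ∩ {ω | b < w v ω})) :=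
          measureReal_biUnion_finset_le _ _
      _ ≤ ∑ u ∈ triangle n, 2 * ((n : ℝ) ^ 2 / K) * (p * p) := by
          refine Finset.sum_le_sum fun u _ => ?_
          calc _ ≤ ∑ v ∈ S u, P.real ({ω | b < w u ω} ∩ {ω | b < w v ω}) :=
                measureReal_biUnion_finset_le _ _
            _ ≤ ∑ v ∈ S u, p * p := Finset.sum_le_sum (hpair u)
            _ = (S u).card * (p * p) := by rw [Finset.sum_const, nsmul_eq_mul]
            _ ≤ _ := by
                refine mul_le_mul_of_nonneg_right ?_ (by positivity)
                have : ((S u).card : ℝ) ≤ (2 * (q * n) : ℕ) := by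
                  exact_mod_cast card_filter_same_row_le hq0 u
                refine this.trans ?_
                rw [Nat.cast_mul, Nat.cast_two]
                exact mul_le_mul_of_nonneg_left hqn (by norm_num)
      _ ≤ _ := by
          rw [Finset.sum_const, nsmul_eq_mul]
          refine mul_le_mul_of_nonneg_right ?_ (by positivity)
          exact_mod_cast card_triangle_le n
  have h2 : P.real (⋃ v ∈ D, {ω | b < w v ω}) ≤ 2 * ((n : ℝ) ^ 2 / K) * p := by
    calc _ ≤ ∑ v ∈ D, P.real {ω | b < w v ω} := measureReal_biUnion_finset_le _ _
      _ ≤ ∑ v ∈ D, p := Finset.sum_le_sum fun v _ => htail v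
      _ = D.card * p := by rw [Finset.sum_const, nsmul_eq_mul]
      _ ≤ _ := by
          refine mul_le_mul_of_nonneg_right ?_ hp0
          have : (D.card : ℝ) ≤ (2 * (q * n) : ℕ) := by
            exact_mod_cast card_filter_cell_le hK hn
          refine this.trans ?_
          rw [Nat.cast_mul, Nat.cast_two]
          exact mul_le_mul_of_nonneg_left hqn (by norm_num)
  refine (measureReal_mono hsub).trans ((measureReal_union_le _ _).trans
    ((add_le_add h1 h2).trans (le_of_eq ?_)))
  rw [hp]
  field_simp

/-- The maximal weight of a chain is close to that of a chain of maxima over squares, uniformly in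
the size of the triangle. -/
theorem exists_block_approx {α : ℝ} (hα0 : 0 < α) (hα2 : α < 2) {η : ℝ} (hη : 0 < η) :
    ∃ K : ℕ, 0 < K ∧ ∀ {Ω : Type*} [MeasurableSpace Ω] {P : Measure Ω} [IsProbabilityMeasure P]
      {w : (Fin 2 → ℕ) → Ω → ℝ}, IsUnitParetoField α w P → ∀ n : ℕ, K ^ 2 ≤ n →
      P.real {ω | η * (n : ℝ) ^ (2 / α) ≤ |chainMax (· ≤ ·) (fun v => w v ω) n -
        chainMax StrongLT (boxMax (n / K) (fun v => w v ω)) (K - 1)|} ≤ η := by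
  have hγ : 0 < 1 - α / 2 := by linarith
  have hT := truncConst_pos hα2
  -- δ makes the small rewards cost at most η/2 in probability; only then is `K` chosen, to make
  -- failure of separation cost the other half.
  obtain ⟨δ, hδ, hδη⟩ : ∃ δ : ℝ, 0 < δ ∧ truncConst α * δ ^ (1 - α / 2) / η ≤ η / 2 := by
    refine ⟨(η ^ 2 / (2 * truncConst α)) ^ (1 - α / 2)⁻¹, by positivity, ?_⟩
    rw [Real.rpow_inv_rpow (by positivity) hγ.ne']
    refine le_of_eq ?_
    field_simp
  obtain ⟨K, hK⟩ := exists_nat_gt (2 * (δ ^ (-α) * δ ^ (-α) + δ ^ (-α)) / (η / 2))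
  have hK0 : (0 : ℝ) < K := lt_of_le_of_lt (by positivity) hK
  have hKpos : 0 < K := by exact_mod_cast hK0
  refine ⟨K, hKpos, fun {Ω} _ {P} _ {w} h n hn => ?_⟩
  have hn1 : 1 ≤ n := le_trans (Nat.one_le_pow _ _ hKpos) hn
  have hqK : K ≤ n / K := (Nat.le_div_iff_mul_le hKpos).2 (by rwa [← sq])
  have hq0 : 0 < n / K := hKpos.trans_le hqK
  have hsub : {ω | η * (n : ℝ) ^ (2 / α) ≤ |chainMax (· ≤ ·) (fun v => w v ω) n -
        chainMax StrongLT (boxMax (n / K) (fun v => w v ω)) (K - 1)|} ⊆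
      {ω | ¬ Separated (δ * (n : ℝ) ^ (2 / α)) (fun v => w v ω) K n (n / K)} ∪
      {ω | η * (n : ℝ) ^ (2 / α) ≤ truncMax (δ * (n : ℝ) ^ (2 / α)) (fun v => w v ω) n} := by
    intro ω hω
    by_cases hs : Separated (δ * (n : ℝ) ^ (2 / α)) (fun v => w v ω) K n (n / K)
    · right
      have h1 := chainMax_le_of_separated hq0 hs
      have h2 := chainMax_boxMax_le hq0 (fun v => w v ω) (Nat.mul_div_le n K)
      have h3 : η * (n : ℝ) ^ (2 / α) ≤ |chainMax (· ≤ ·) (fun v => w v ω) n -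
        chainMax StrongLT (boxMax (n / K) (fun v => w v ω)) (K - 1)| := hω
      rw [abs_of_nonneg (by linarith)] at h3
      exact h3.trans (by linarith)
    · exact Or.inl hs
  refine (measureReal_mono hsub).trans ((measureReal_union_le _ _).trans ?_)
  have h1 := h.measureReal_not_separated_le hα0 hδ hKpos hn
  have h2 := h.measureReal_truncMax_ge_le hα0 hα2 hδ hη hn1
  have h3 : 2 * (δ ^ (-α) * δ ^ (-α) + δ ^ (-α)) / K ≤ η / 2 := by
    rw [div_lt_iff₀ (by positivity)] at hK
    rw [div_le_iff₀ hK0]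
    linarith
  linarith

/-- Real random variables whose joint distribution function factorises are independent. -/
theorem iIndepFun_of_forall_Iic {ι : Type*} {M : ι → Ω → ℝ} (hM : ∀ c, Measurable (M c))
    (h : ∀ (s : Finset ι) (y : ι → ℝ),
      P (⋂ c ∈ s, M c ⁻¹' Set.Iic (y c)) = ∏ c ∈ s, P (M c ⁻¹' Set.Iic (y c))) :
    iIndepFun M P := by
  classical
  rw [iIndepFun_iff_iIndep]
  refine iIndepSets.iIndep (fun c => (hM c).comap_le)
    (fun c => {t | ∃ s ∈ Set.range Set.Iic, M c ⁻¹' s = t}) (fun c => isPiSystem_Iic.comap (M c))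
    (fun c => ?_) ?_
  · rw [BorelSpace.measurable_eq (α := ℝ), borel_eq_generateFrom_Iic,
      MeasurableSpace.comap_generateFrom]
    rfl
  · rw [iIndepSets_iff]
    intro s f hf
    choose! t ht htf using hf
    choose! y hy using ht
    have e : ∀ c ∈ s, f c = M c ⁻¹' Set.Iic (y c) := fun c hc => by rw [hy c hc, htf c hc]
    rw [Set.iInter₂_congr e, Finset.prod_congr rfl fun c hc => by rw [e c hc]]
    exact h s y

theorem preimage_boxMax_Iic {Ω : Type*} (w : (Fin 2 → ℕ) → Ω → ℝ) {q : ℕ} (hq : 0 < q)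
    (c : Fin 2 → ℕ) (y : ℝ) :
    (fun ω => boxMax q (fun v => w v ω) c) ⁻¹' Set.Iic y = ⋂ v ∈ box q c, w v ⁻¹' Set.Iic y := by
  ext ω
  simp [boxMax_le_iff hq]

namespace IsUnitParetoField

theorem measurable_boxMax (h : IsUnitParetoField α w P) (q : ℕ) (c : Fin 2 → ℕ) :
    Measurable fun ω => boxMax q (fun v => w v ω) c :=
  (continuous_boxMax q c).measurable.comp (measurable_pi_lambda _ h.meas)

theorem iIndepFun_boxMax (h : IsUnitParetoField α w P) {q : ℕ} (hq : 0 < q) :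
    iIndepFun (fun c ω => boxMax q (fun v => w v ω) c) P := by
  classical
  refine iIndepFun_of_forall_Iic (h.measurable_boxMax q) fun s y => ?_
  -- Writing the level as a function of the cell lets all vertices of a union of squares be treated
  -- in one product.
  have hprod : ∀ c, P ((fun ω => boxMax q (fun v => w v ω) c) ⁻¹' Set.Iic (y c))
      = ∏ v ∈ box q c, P (w v ⁻¹' Set.Iic (y (cell q v))) := fun c => by
    rw [preimage_boxMax_Iic w hq, h.indep.measure_inter_preimage_eq_mul _
      (fun _ _ => measurableSet_Iic)]
    exact Finset.prod_congr rfl fun v hv => by rw [(mem_box hq).1 hv]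
  have hdisj : Set.PairwiseDisjoint (s : Set (Fin 2 → ℕ)) (box q) := by
    intro c _ d _ hne
    refine Finset.disjoint_left.2 fun v hv hv' => hne ?_
    rw [← (mem_box hq).1 hv, ← (mem_box hq).1 hv']
  rw [Finset.prod_congr rfl fun c _ => hprod c, ← Finset.prod_biUnion hdisj,
    ← h.indep.measure_inter_preimage_eq_mul _ (sets := fun v => Set.Iic (y (cell q v)))
      (fun _ _ => measurableSet_Iic)]
  congr 1
  ext ω
  simp only [Set.mem_iInter, Set.mem_preimage, Set.mem_Iic, boxMax_le_iff hq, Finset.mem_biUnion]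
  constructor
  · rintro H v ⟨c, hc, hv⟩
    rw [(mem_box hq).1 hv]
    exact H c hc v hv
  · intro H c hc v hv
    have := H v ⟨c, hc, hv⟩
    rwa [(mem_box hq).1 hv] at this

theorem measureReal_boxMax_le [IsProbabilityMeasure P] (h : IsUnitParetoField α w P) (hα : 0 < α)
    {q : ℕ} (hq : 0 < q) (c : Fin 2 → ℕ) (y : ℝ) :
    P.real {ω | boxMax q (fun v => w v ω) c ≤ y} = (1 - (max y 1) ^ (-α)) ^ (q ^ 2) := by
  simp only [boxMax_le_iff hq]
  rw [h.measureReal_forall_le hα, card_box]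

end IsUnitParetoField
end Prob

/-! ### Square maxima as quantiles of uniform variables, and their limit. -/

/-- The uniform distribution on the unit interval. -/
noncomputable def unitUniform : Measure ℝ := volume.restrict (Set.Ioo 0 1)

instance : IsProbabilityMeasure unitUniform := ⟨by simp [unitUniform]⟩

/-- The quantile function of the maximum of `N` independent Pareto variables of scale `1`. -/
noncomputable def maxQuantile (α : ℝ) (N : ℕ) (u : ℝ) : ℝ := (1 - u ^ (N : ℝ)⁻¹) ^ (-α)⁻¹

theorem measurable_maxQuantile (α : ℝ) (N : ℕ) : Measurable (maxQuantile α N) := by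
  unfold maxQuantile
  exact (measurable_const.sub (measurable_id.pow_const _)).pow_const _

theorem maxQuantile_le_iff {α : ℝ} (hα : 0 < α) {N : ℕ} (hN : 0 < N) {u : ℝ} (hu0 : 0 < u)
    (hu1 : u < 1) (y : ℝ) : maxQuantile α N u ≤ y ↔ u ≤ (1 - (max y 1) ^ (-α)) ^ N := by
  have hN0 : (0 : ℝ) < N := by exact_mod_cast hN
  have hx0 : 0 < u ^ (N : ℝ)⁻¹ := by positivity
  have hx1 : u ^ (N : ℝ)⁻¹ < 1 := Real.rpow_lt_one hu0.le hu1 (by positivity)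
  have hz : 0 < 1 - u ^ (N : ℝ)⁻¹ := by linarith
  have hm : 1 ≤ max y 1 := le_max_right _ _
  have hm1 : (max y 1) ^ (-α) ≤ 1 := Real.rpow_le_one_of_one_le_of_nonpos hm (by linarith)
  have hgt : 1 < maxQuantile α N u :=
    Real.one_lt_rpow_of_pos_of_lt_one_of_neg hz (by linarith) (inv_lt_zero.2 (by linarith))
  have h1 : maxQuantile α N u ≤ y ↔ maxQuantile α N u ≤ max y 1 := by
    rw [le_max_iff]
    exact ⟨Or.inl, fun h => h.resolve_right (not_le.2 hgt)⟩
  rw [h1, maxQuantile, Real.rpow_inv_le_iff_of_neg hz (by linarith) (by linarith), le_sub_comm,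
    Real.rpow_inv_le_iff_of_pos hu0.le (by linarith) hN0, Real.rpow_natCast]

theorem unitUniform_real_maxQuantile_le {α : ℝ} (hα : 0 < α) {N : ℕ} (hN : 0 < N) (y : ℝ) :
    unitUniform.real {u | maxQuantile α N u ≤ y} = (1 - (max y 1) ^ (-α)) ^ N := by
  have hm : 1 ≤ max y 1 := le_max_right _ _
  have hm0 : 0 < (max y 1) ^ (-α) := by positivity
  have hm1 : (max y 1) ^ (-α) ≤ 1 := Real.rpow_le_one_of_one_le_of_nonpos hm (by linarith)
  have ha0 : 0 ≤ (1 - (max y 1) ^ (-α)) ^ N := pow_nonneg (by linarith) _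
  have ha1 : (1 - (max y 1) ^ (-α)) ^ N < 1 := pow_lt_one₀ (by linarith) (by linarith) hN.ne'
  have e : {u | maxQuantile α N u ≤ y} ∩ Set.Ioo 0 1 =
      Set.Ioc 0 ((1 - (max y 1) ^ (-α)) ^ N) := by
    ext u
    constructor
    · rintro ⟨h, h0, h1⟩
      exact ⟨h0, (maxQuantile_le_iff hα hN h0 h1 y).1 h⟩
    · rintro ⟨h0, h⟩
      have h1 := h.trans_lt ha1
      exact ⟨(maxQuantile_le_iff hα hN h0 h1 y).2 h, h0, h1⟩
  rw [measureReal_def, unitUniform,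
    Measure.restrict_apply (measurableSet_le (measurable_maxQuantile α N) measurable_const), e,
    Real.volume_Ioc, sub_zero, ENNReal.toReal_ofReal ha0]

/-- Minus the difference quotient of t ↦ u^t at 0, with t = 1/x. -/
theorem tendsto_mul_one_sub_rpow_inv {u : ℝ} (hu : 0 < u) :
    Tendsto (fun x : ℝ => x * (1 - u ^ x⁻¹)) atTop (𝓝 (-Real.log u)) := by
  have h1 : HasDerivAt (fun t : ℝ => u ^ t) (Real.log u) 0 := by
    simpa using (hasDerivAt_id (0 : ℝ)).const_rpow hu
  have h2 := (hasDerivAt_iff_tendsto_slope_zero.1 h1).comp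
    (tendsto_nhdsWithin_iff.2 ⟨tendsto_inv_atTop_zero (𝕜 := ℝ),
      (eventually_gt_atTop 0).mono fun x hx => by
        simp only [Set.mem_compl_iff, Set.mem_singleton_iff, inv_eq_zero]; exact hx.ne'⟩)
  refine (h2.neg).congr fun x => ?_
  simp
  ring

theorem tendsto_natCast_div_div {K : ℕ} (hK : 0 < K) :
    Tendsto (fun n : ℕ => (n : ℝ) / ((n / K : ℕ) : ℝ)) atTop (𝓝 K) := by
  have hK0 : (0 : ℝ) < K := by exact_mod_cast hK
  have h := (tendsto_nat_floor_mul_div_atTop (R := ℝ) (a := (K : ℝ)⁻¹) (by positivity)).comp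
    tendsto_natCast_atTop_atTop
  have h2 := h.inv₀ (by positivity)
  rw [inv_inv] at h2
  refine h2.congr fun n => ?_
  simp only [Function.comp_apply]
  rw [inv_div, inv_mul_eq_div, Nat.floor_div_eq_div]

/-- With N = (n/K)² one has 1 - u^(1/N) ~ -log u / N and n²/N → K²; the power -1/α turns n² into
n^(2/α). The limit is a Fréchet variable when u is uniform. -/
theorem tendsto_maxQuantile_div (α : ℝ) {K : ℕ} (hK : 0 < K) {u : ℝ} (hu0 : 0 < u)
    (hu1 : u < 1) :
    Tendsto (fun n : ℕ => maxQuantile α ((n / K) ^ 2) u / (n : ℝ) ^ (2 / α)) atTop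
      (𝓝 ((-Real.log u * (K : ℝ) ^ 2) ^ (-α)⁻¹)) := by
  have hK0 : (0 : ℝ) < K := by exact_mod_cast hK
  have hlog : 0 < -Real.log u := neg_pos.2 (Real.log_neg hu0 hu1)
  have hq : Tendsto (fun n : ℕ => (((n / K) ^ 2 : ℕ) : ℝ)) atTop atTop :=
    tendsto_natCast_atTop_atTop.comp ((tendsto_pow_atTop two_ne_zero).comp
      (Nat.tendsto_div_const_atTop hK.ne'))
  have h := (((tendsto_mul_one_sub_rpow_inv hu0).comp hq).mul
    ((tendsto_natCast_div_div hK).pow 2)).rpow_const (p := (-α)⁻¹) (Or.inl (by positivity))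
  refine h.congr' ?_
  filter_upwards [eventually_ge_atTop K] with n hn
  have hq0 : 0 < n / K := Nat.div_pos hn hK
  have hq1 : (0 : ℝ) < (n / K : ℕ) := by exact_mod_cast hq0
  have hn0 : (0 : ℝ) < n := by exact_mod_cast hK.trans_le hn
  have hN : (0 : ℝ) < ((n / K) ^ 2 : ℕ) := by exact_mod_cast pow_pos hq0 2
  have hz : 0 < 1 - u ^ (((n / K) ^ 2 : ℕ) : ℝ)⁻¹ := by
    have := Real.rpow_lt_one hu0.le hu1 (inv_pos.2 hN)
    linarith
  have e : ((fun x : ℝ => x * (1 - u ^ x⁻¹)) ∘ fun n : ℕ => (((n / K) ^ 2 : ℕ) : ℝ)) n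
      * ((n : ℝ) / ((n / K : ℕ) : ℝ)) ^ 2 = (1 - u ^ (((n / K) ^ 2 : ℕ) : ℝ)⁻¹) * (n : ℝ) ^ 2 := by
    simp only [Function.comp_apply]
    have : (((n / K) ^ 2 : ℕ) : ℝ) = ((n / K : ℕ) : ℝ) ^ 2 := by push_cast; rfl
    rw [div_pow, this]
    field_simp
  rw [e, Real.mul_rpow hz.le (by positivity), maxQuantile, div_eq_mul_inv]
  congr 1
  rw [← Real.rpow_natCast, ← Real.rpow_mul hn0.le, ← Real.rpow_neg hn0.le]
  congr 1
  rw [inv_neg]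
  push_cast
  ring

theorem ae_infinitePi_unitUniform :
    ∀ᵐ u ∂(Measure.infinitePi fun _ : Fin 2 → ℕ => unitUniform), ∀ c, u c ∈ Set.Ioo (0 : ℝ) 1 := by
  rw [ae_all_iff]
  intro c
  exact (measurePreserving_eval_infinitePi (fun _ : Fin 2 → ℕ => unitUniform) c
    ).quasiMeasurePreserving.ae (ae_restrict_mem measurableSet_Ioo)

/-- The limiting law of the maximal weight of a chain of maxima over squares. -/
theorem tendsto_integral_unitUniform (α : ℝ) {K : ℕ} (hK : 0 < K) (m : ℕ)
    (f : ℝ →ᵇ ℝ) :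
    ∃ L : ℝ, Tendsto (fun n : ℕ => ∫ u, f (chainMax StrongLT
      (fun c => maxQuantile α ((n / K) ^ 2) (u c)) m / (n : ℝ) ^ (2 / α))
      ∂(Measure.infinitePi fun _ : Fin 2 → ℕ => unitUniform)) atTop (𝓝 L) := by
  -- One uniform family serves all `n`, so the convergence holds almost surely: coordinatewise, then
  -- through the continuous `chainMax`.
  refine ⟨_, tendsto_integral_of_dominated_convergence
    (f := fun u => f (chainMax StrongLT (fun c => (-Real.log (u c) * (K : ℝ) ^ 2) ^ (-α)⁻¹) m))
    (fun _ => ‖f‖) (fun n => ?_) (integrable_const _) (fun n => ae_of_all _ fun u =>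
      f.norm_coe_le_norm _) ?_⟩
  · refine (f.continuous.measurable.comp (Measurable.div_const ?_ _)).aestronglyMeasurable
    exact (measurable_chainMax _ _).comp (measurable_pi_lambda _ fun c =>
      (measurable_maxQuantile _ _).comp (measurable_pi_apply c))
  · filter_upwards [ae_infinitePi_unitUniform] with u hu
    refine (f.continuous.tendsto _).comp ?_
    have h := ((continuous_chainMax StrongLT m).tendsto
      (fun c => (-Real.log (u c) * (K : ℝ) ^ 2) ^ (-α)⁻¹)).comp
      (tendsto_pi_nhds.2 fun c => tendsto_maxQuantile_div α hK (hu c).1 (hu c).2)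
    refine h.congr fun n => ?_
    simp only [Function.comp_apply]
    rw [chainMax_div (by positivity)]

namespace IsUnitParetoField
variable {Ω : Type*} [MeasurableSpace Ω] {P : Measure Ω} [IsProbabilityMeasure P]
  {α : ℝ} {w : (Fin 2 → ℕ) → Ω → ℝ}

/-- Both fields are independent with the same one-dimensional distribution functions. This replaces
the maxima by functions of uniform variables that do not vary with the size of the square. -/
theorem map_boxMax (h : IsUnitParetoField α w P) (hα : 0 < α) {q : ℕ} (hq : 0 < q) :
    P.map (fun ω c => boxMax q (fun v => w v ω) c) =
      (Measure.infinitePi fun _ : Fin 2 → ℕ => unitUniform).map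
        (fun u c => maxQuantile α (q ^ 2) (u c)) := by
  rw [(h.iIndepFun_boxMax hq).map_fun_eq_infinitePi_map (h.measurable_boxMax q),
    Measure.infinitePi_map_pi (fun _ => unitUniform)
      (f := fun (_ : Fin 2 → ℕ) => maxQuantile α (q ^ 2)) fun _ => measurable_maxQuantile _ _]
  congr 1
  funext c
  have := Measure.isProbabilityMeasure_map (μ := P) (h.measurable_boxMax q c).aemeasurable
  refine Measure.ext_of_Iic _ _ fun y => ?_
  rw [Measure.map_apply (h.measurable_boxMax q c) measurableSet_Iic,
    Measure.map_apply (measurable_maxQuantile _ _) measurableSet_Iic]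
  have e := (h.measureReal_boxMax_le hα hq c y).trans
    (unitUniform_real_maxQuantile_le hα (pow_pos hq 2) y).symm
  exact (ENNReal.toReal_eq_toReal_iff' (measure_ne_top _ _) (measure_ne_top _ _)).1 e

theorem tendsto_integral_block (h : IsUnitParetoField α w P) (hα : 0 < α) {K : ℕ} (hK : 0 < K)
    (m : ℕ) (f : ℝ →ᵇ ℝ) :
    ∃ L : ℝ, Tendsto (fun n : ℕ => ∫ ω, f (chainMax StrongLT
      (boxMax (n / K) (fun v => w v ω)) m / (n : ℝ) ^ (2 / α)) ∂P) atTop (𝓝 L) := by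
  obtain ⟨L, hL⟩ := tendsto_integral_unitUniform α hK m f
  refine ⟨L, hL.congr' ?_⟩
  filter_upwards [eventually_ge_atTop K] with n hn
  have hq : 0 < n / K := Nat.div_pos hn hK
  set g : ((Fin 2 → ℕ) → ℝ) → ℝ := fun x => f (chainMax StrongLT x m / (n : ℝ) ^ (2 / α)) with hg
  have hgm : Measurable g :=
    f.continuous.measurable.comp ((LatticeReward.measurable_chainMax _ _).div_const _)
  have h1 := integral_map (μ := P) (f := g)
    (measurable_pi_lambda _ (h.measurable_boxMax (n / K))).aemeasurable hgm.aestronglyMeasurable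
  have h2 := integral_map (μ := Measure.infinitePi fun _ : Fin 2 → ℕ => unitUniform) (f := g)
    (φ := fun u c => maxQuantile α ((n / K) ^ 2) (u c))
    (measurable_pi_lambda _ fun c => (measurable_maxQuantile _ _).comp
      (measurable_pi_apply c)).aemeasurable hgm.aestronglyMeasurable
  rw [h.map_boxMax hα hq] at h1
  exact h2.symm.trans h1

end IsUnitParetoField

/-! ### Weak convergence of the scaled maximum. -/

/-- A Cauchy argument: the limits of the approximating sequences need not be identified or shown to
converge. -/
theorem exists_tendsto_of_approx {a : ℕ → ℝ}
    (h : ∀ ε > 0, ∃ b : ℕ → ℝ, (∃ l, Tendsto b atTop (𝓝 l)) ∧ ∀ᶠ n in atTop, |a n - b n| ≤ ε) :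
    ∃ l, Tendsto a atTop (𝓝 l) := by
  refine cauchySeq_tendsto_of_complete (Metric.cauchySeq_iff.2 fun ε hε => ?_)
  obtain ⟨b, ⟨l, hb⟩, hab⟩ := h (ε / 5) (by positivity)
  obtain ⟨N₁, hN₁⟩ := eventually_atTop.1 hab
  obtain ⟨N₂, hN₂⟩ := Metric.cauchySeq_iff.1 hb.cauchySeq (ε / 5) (by positivity)
  refine ⟨max N₁ N₂, fun m hm n hn => ?_⟩
  have h1 := hN₁ m (le_of_max_le_left hm)
  have h2 := hN₁ n (le_of_max_le_left hn)
  have h3 := hN₂ m (le_of_max_le_right hm) n (le_of_max_le_right hn)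
  rw [Real.dist_eq, abs_lt] at *
  rw [abs_le] at h1 h2
  constructor <;> linarith

/-- A tight sequence of laws for which the integrals of bounded Lipschitz functions converge
converges weakly. -/
theorem exists_tendsto_of_isTight {μ : ℕ → ProbabilityMeasure ℝ}
    (ht : IsTightMeasureSet {(μ n : Measure ℝ) | n})
    (h : ∀ (f : ℝ →ᵇ ℝ) (L : ℝ≥0), LipschitzWith L f →
      ∃ l, Tendsto (fun n => ∫ x, f x ∂(μ n : Measure ℝ)) atTop (𝓝 l)) :
    ∃ ν, Tendsto μ atTop (𝓝 ν) := by
  have h_compact : IsCompact (closure {μ n | n}) :=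
    isCompact_closure_of_isTightMeasureSet (by simpa using ht)
  -- Compactness gives a limit along an ultrafilter. The integrals converge along the whole
  -- sequence, so their limits are those of this candidate.
  let U : Ultrafilter ℕ := Ultrafilter.of atTop
  have hU : (U : Filter ℕ) ≤ atTop := Ultrafilter.of_le _
  obtain ⟨ν, -, hν : Tendsto μ U (𝓝 ν)⟩ := h_compact.ultrafilter_le_nhds (U.map μ)
    (.trans (by simp) (monotone_principal subset_closure))
  refine ⟨ν, tendsto_iff_forall_lipschitz_integral_tendsto.2 ?_⟩
  rintro f ⟨C, hC⟩ ⟨L, hL⟩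
  let g : ℝ →ᵇ ℝ := BoundedContinuousFunction.mkOfBound ⟨f, hL.continuous⟩ C hC
  obtain ⟨l, hl⟩ := h g L hL
  have h1 : Tendsto (fun n => ∫ x, g x ∂(μ n : Measure ℝ)) U (𝓝 (∫ x, g x ∂(ν : Measure ℝ))) :=
    ProbabilityMeasure.tendsto_iff_forall_integral_tendsto.1 hν g
  rw [tendsto_nhds_unique (hl.mono_left hU) h1] at hl
  exact hl

/-- The Lipschitz bound applies where the variables are close, and 2‖f‖ elsewhere. -/
theorem abs_integral_sub_le {Ω : Type*} [MeasurableSpace Ω] {P : Measure Ω}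
    [IsProbabilityMeasure P] {X Y : Ω → ℝ} (hX : Measurable X) (hY : Measurable Y) (f : ℝ →ᵇ ℝ)
    {L : ℝ≥0} (hL : LipschitzWith L f) {η : ℝ} (hη : 0 ≤ η) :
    |∫ ω, f (X ω) ∂P - ∫ ω, f (Y ω) ∂P| ≤ L * η + 2 * ‖f‖ * P.real {ω | η ≤ |X ω - Y ω|} := by
  have hfX : Integrable (fun ω => f (X ω)) P :=
    Integrable.of_bound (f.continuous.measurable.comp hX).aestronglyMeasurable ‖f‖
      (ae_of_all _ fun ω => f.norm_coe_le_norm _)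
  have hfY : Integrable (fun ω => f (Y ω)) P :=
    Integrable.of_bound (f.continuous.measurable.comp hY).aestronglyMeasurable ‖f‖
      (ae_of_all _ fun ω => f.norm_coe_le_norm _)
  have hS : MeasurableSet {ω | η ≤ |X ω - Y ω|} :=
    measurableSet_le measurable_const (hX.sub hY).abs
  rw [← integral_sub hfX hfY]
  refine abs_integral_le_integral_abs.trans ?_
  have hI : Integrable (fun ω => L * η +
      Set.indicator {ω | η ≤ |X ω - Y ω|} (fun _ => 2 * ‖f‖) ω) P :=
    (integrable_const _).add ((integrable_const _).indicator hS)
  refine (integral_mono (hfX.sub hfY).abs hI fun ω => ?_).trans (le_of_eq ?_)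
  · by_cases hω : ω ∈ {ω | η ≤ |X ω - Y ω|}
    · simp only [Set.indicator_of_mem hω]
      have h1 := f.norm_coe_le_norm (X ω)
      have h2 := f.norm_coe_le_norm (Y ω)
      have h3 : |f (X ω) - f (Y ω)| ≤ |f (X ω)| + |f (Y ω)| := abs_sub _ _
      rw [Real.norm_eq_abs] at h1 h2
      have : 0 ≤ (L : ℝ) * η := by positivity
      exact h3.trans (by linarith)
    · simp only [Set.indicator_of_notMem hω, add_zero]
      have h1 := hL.dist_le_mul (X ω) (Y ω)
      rw [Real.dist_eq, Real.dist_eq] at h1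
      exact h1.trans (mul_le_mul_of_nonneg_left (not_le.1 hω).le L.2)
  · rw [integral_add (integrable_const _) ((integrable_const _).indicator hS),
      integral_indicator_const _ hS]
    simp
    ring

/-- The constant in the uniform upper bound with failure probability `ε`. -/
theorem exists_upper_const {α : ℝ} (hα0 : 0 < α) (hα2 : α < 2) {ε : ℝ} (hε : 0 < ε) :
    ∃ C : ℝ, 0 < C ∧ ∀ {Ω : Type*} [MeasurableSpace Ω] {P : Measure Ω} [IsProbabilityMeasure P]
      {w : (Fin 2 → ℕ) → Ω → ℝ}, IsUnitParetoField α w P → ∀ n : ℕ, 1 ≤ n →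
      P.real {ω | C * (n : ℝ) ^ (2 / α) < chainMax (· ≤ ·) (fun v => w v ω) n} ≤ ε := by
  have hT := truncConst_pos hα2
  -- This makes δ^(-α) = ε/2; the constant `C` below makes the other term equal to ε/2.
  set δ : ℝ := (ε / 2) ^ (-α)⁻¹ with hδ
  have hδ0 : 0 < δ := by positivity
  have hC : 0 < 2 * (truncConst α * δ ^ (1 - α / 2)) / ε := by positivity
  refine ⟨_, hC, fun h n hn => (h.measureReal_chainMax_gt_le hα0 hα2 hδ0 hC hn).trans
    (le_of_eq ?_)⟩
  rw [hδ, Real.rpow_inv_rpow (by positivity) (by linarith), ← hδ]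
  have : 0 < δ ^ (1 - α / 2) := by positivity
  field_simp
  ring

/-- The constant in the uniform lower bound with failure probability `ε`. -/
theorem exists_lower_const {α : ℝ} (hα0 : 0 < α) {ε : ℝ} (hε : 0 < ε) :
    ∃ c : ℝ, 0 < c ∧ ∀ {Ω : Type*} [MeasurableSpace Ω] {P : Measure Ω} [IsProbabilityMeasure P]
      {w : (Fin 2 → ℕ) → Ω → ℝ}, IsUnitParetoField α w P → ∀ n : ℕ, 1 ≤ n →
      P.real {ω | chainMax (· ≤ ·) (fun v => w v ω) n ≤ c * (n : ℝ) ^ (2 / α)} ≤ ε := by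
  -- The exponent c^(-α)/4 becomes 1/ε, and exp(-1/ε) ≤ ε.
  refine ⟨(4 / ε) ^ (-α)⁻¹, by positivity, fun h n hn =>
    (h.measureReal_chainMax_le_le hα0 (by positivity) hn).trans ?_⟩
  rw [Real.rpow_inv_rpow (by positivity) (by linarith), Real.exp_neg,
    show 4 / ε / 4 = 1 / ε by field_simp]
  refine inv_le_of_inv_le₀ hε ?_
  have := Real.add_one_le_exp (1 / ε)
  rw [← one_div]
  linarith

namespace IsUnitParetoField
variable {Ω : Type*} [MeasurableSpace Ω] {P : Measure Ω}
  {α : ℝ} {w : (Fin 2 → ℕ) → Ω → ℝ}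

theorem measurable_scaled (h : IsUnitParetoField α w P) (n : ℕ) :
    Measurable fun ω => chainMax (· ≤ ·) (fun v => w v ω) n / (n : ℝ) ^ (2 / α) :=
  (h.measurable_chainMax _ n).div_const _

variable [IsProbabilityMeasure P]

theorem exists_tendsto_integral (h : IsUnitParetoField α w P) (hα0 : 0 < α) (hα2 : α < 2)
    (f : ℝ →ᵇ ℝ) {L : ℝ≥0} (hL : LipschitzWith L f) :
    ∃ l, Tendsto (fun n : ℕ => ∫ ω, f (chainMax (· ≤ ·) (fun v => w v ω) n / (n : ℝ) ^ (2 / α)) ∂P)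
      atTop (𝓝 l) := by
  refine exists_tendsto_of_approx fun ε hε => ?_
  have hD : 0 < (L : ℝ) + 2 * ‖f‖ + 1 := by positivity
  obtain ⟨K, hK, hap⟩ := exists_block_approx hα0 hα2 (η := ε / (L + 2 * ‖f‖ + 1)) (by positivity)
  set η := ε / (L + 2 * ‖f‖ + 1) with hη
  have hη0 : 0 < η := by positivity
  refine ⟨_, h.tendsto_integral_block hα0 hK (K - 1) f, ?_⟩
  filter_upwards [eventually_ge_atTop (K ^ 2)] with n hn
  have hn1 : 1 ≤ n := le_trans (Nat.one_le_pow _ _ hK) hn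
  have hn0 : (0 : ℝ) < n := by exact_mod_cast hn1
  have hN : 0 < (n : ℝ) ^ (2 / α) := by positivity
  have hmY : Measurable fun ω => chainMax StrongLT (boxMax (n / K) (fun v => w v ω)) (K - 1)
      / (n : ℝ) ^ (2 / α) :=
    ((LatticeReward.measurable_chainMax _ _).comp
      (measurable_pi_lambda _ (h.measurable_boxMax _))).div_const _
  refine (abs_integral_sub_le (h.measurable_scaled n) hmY f hL hη0.le).trans ?_
  have e : {ω | η ≤ |chainMax (· ≤ ·) (fun v => w v ω) n / (n : ℝ) ^ (2 / α) -
      chainMax StrongLT (boxMax (n / K) (fun v => w v ω)) (K - 1) / (n : ℝ) ^ (2 / α)|} =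
      {ω | η * (n : ℝ) ^ (2 / α) ≤ |chainMax (· ≤ ·) (fun v => w v ω) n -
        chainMax StrongLT (boxMax (n / K) (fun v => w v ω)) (K - 1)|} := by
    ext ω
    rw [Set.mem_ofPred_eq, Set.mem_ofPred_eq, ← sub_div, abs_div, abs_of_pos hN, le_div_iff₀ hN]
  rw [e]
  have h1 := mul_le_mul_of_nonneg_left (hap h n hn) (show 0 ≤ 2 * ‖f‖ by positivity)
  have h2 : η * (L + 2 * ‖f‖ + 1) = ε := by rw [hη]; field_simp
  nlinarith

/-- The law of the scaled maximal weight of a chain. -/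
noncomputable def scaledLaw (h : IsUnitParetoField α w P) (n : ℕ) : ProbabilityMeasure ℝ :=
  ⟨P.map fun ω => chainMax (· ≤ ·) (fun v => w v ω) n / (n : ℝ) ^ (2 / α),
    Measure.isProbabilityMeasure_map (h.measurable_scaled n).aemeasurable⟩

theorem scaledLaw_apply (h : IsUnitParetoField α w P) (n : ℕ) {s : Set ℝ} (hs : MeasurableSet s) :
    (h.scaledLaw n : Measure ℝ) s =
      P {ω | chainMax (· ≤ ·) (fun v => w v ω) n / (n : ℝ) ^ (2 / α) ∈ s} :=
  Measure.map_apply (h.measurable_scaled n) hs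

theorem isTight_scaledLaw (h : IsUnitParetoField α w P) (hα0 : 0 < α) (hα2 : α < 2) :
    IsTightMeasureSet {(h.scaledLaw n : Measure ℝ) | n} := by
  rw [isTightMeasureSet_iff_exists_isCompact_measure_compl_le]
  intro ε hε
  obtain ⟨ε', hε', hle⟩ : ∃ ε' : ℝ, 0 < ε' ∧ ENNReal.ofReal ε' ≤ ε := by
    obtain rfl | hne := eq_or_ne ε ⊤
    · exact ⟨1, one_pos, le_top⟩
    · exact ⟨ε.toReal, ENNReal.toReal_pos hε.ne' hne, ENNReal.ofReal_toReal_le⟩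
  obtain ⟨C, hC, hup⟩ := exists_upper_const hα0 hα2 hε'
  refine ⟨Set.Icc 0 C, isCompact_Icc, ?_⟩
  rintro _ ⟨n, rfl⟩
  rw [h.scaledLaw_apply n measurableSet_Icc.compl]
  have hnn : ∀ ω, 0 ≤ chainMax (· ≤ ·) (fun v => w v ω) n / (n : ℝ) ^ (2 / α) := fun ω =>
    div_nonneg chainMax_nonneg (by positivity)
  -- For `n = 0` the scale is 0, so the quotient is 0 by convention and lies in the compact set.
  rcases Nat.eq_zero_or_pos n with rfl | hn
  · have : {ω | chainMax (· ≤ ·) (fun v => w v ω) 0 / ((0 : ℕ) : ℝ) ^ (2 / α) ∈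
        (Set.Icc 0 C)ᶜ} = ∅ := by
      refine Set.eq_empty_of_forall_notMem fun ω hω => hω ?_
      have : 2 / α ≠ 0 := by positivity
      simp [Real.zero_rpow this, hC.le]
    rw [this, measure_empty]
    exact zero_le
  · have hn0 : (0 : ℝ) < n := by exact_mod_cast hn
    refine le_trans (measure_mono fun ω hω => ?_) ((ENNReal.le_ofReal_iff_toReal_le
      (measure_ne_top _ _) hε'.le).2 (hup h n hn) |>.trans hle)
    by_contra hnot
    refine hω ⟨hnn ω, ?_⟩
    rw [div_le_iff₀ (by positivity)]
    exact not_lt.1 hnot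

theorem exists_tendsto_scaledLaw (h : IsUnitParetoField α w P) (hα0 : 0 < α) (hα2 : α < 2) :
    ∃ ν, Tendsto h.scaledLaw atTop (𝓝 ν) := by
  refine exists_tendsto_of_isTight (h.isTight_scaledLaw hα0 hα2) fun f L hL => ?_
  obtain ⟨l, hl⟩ := h.exists_tendsto_integral hα0 hα2 f hL
  refine ⟨l, hl.congr fun n => ?_⟩
  exact (integral_map (h.measurable_scaled n).aemeasurable
    f.continuous.measurable.aestronglyMeasurable).symm

/-- The lower-tail bound is uniform in n, so the portmanteau inequality for open sets carries it to
the limit. -/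
theorem scaledLaw_limit_Iio_le (h : IsUnitParetoField α w P) (hα0 : 0 < α)
    {ν : ProbabilityMeasure ℝ} (hν : Tendsto h.scaledLaw atTop (𝓝 ν)) {c : ℝ} (hc : 0 < c) :
    (ν : Measure ℝ) (Set.Iio c) ≤ ENNReal.ofReal (Real.exp (-(c ^ (-α) / 4))) := by
  refine (ProbabilityMeasure.le_liminf_measure_open_of_tendsto hν isOpen_Iio).trans ?_
  refine liminf_le_of_frequently_le' (Eventually.frequently ?_)
  filter_upwards [eventually_ge_atTop 1] with n hn
  have hn0 : (0 : ℝ) < n := by exact_mod_cast hn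
  rw [h.scaledLaw_apply n measurableSet_Iio]
  refine le_trans (measure_mono fun ω hω => ?_) ((ENNReal.le_ofReal_iff_toReal_le
    (measure_ne_top _ _) (Real.exp_pos _).le).2 (h.measureReal_chainMax_le_le hα0 hc hn))
  exact ((div_lt_iff₀ (show 0 < (n : ℝ) ^ (2 / α) by positivity)).1 hω).le

/-- The limit law charges neither the nonpositive numbers nor a single point only. -/
theorem scaledLaw_limit_nontrivial (h : IsUnitParetoField α w P) (hα0 : 0 < α)
    {ν : ProbabilityMeasure ℝ} (hν : Tendsto h.scaledLaw atTop (𝓝 ν)) :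
    (ν : Measure ℝ) (Set.Iic 0) = 0 ∧ ∀ x : ℝ, (ν : Measure ℝ) ≠ Measure.dirac x := by
  constructor
  · refine le_zero_iff.1 (ENNReal.le_of_forall_pos_le_add fun ε hε _ => ?_)
    rw [zero_add]
    have hε0 : (0 : ℝ) < ε := hε
    have hc : 0 < (4 / (ε : ℝ)) ^ (-α)⁻¹ := by positivity
    refine (measure_mono (Set.Iic_subset_Iio.2 hc)).trans
      ((h.scaledLaw_limit_Iio_le hα0 hν hc).trans ?_)
    rw [← ENNReal.ofReal_coe_nnreal]
    refine ENNReal.ofReal_le_ofReal ?_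
    rw [Real.rpow_inv_rpow (by positivity) (by linarith), Real.exp_neg,
      show 4 / (ε : ℝ) / 4 = 1 / ε by field_simp]
    refine inv_le_of_inv_le₀ hε0 ?_
    have := Real.add_one_le_exp (1 / (ε : ℝ))
    rw [← one_div]
    linarith
  · intro x hx
    -- A point mass at `x` would give mass 1 to the numbers below this `c`, but the bound is below
    -- 1.
    have hc : 0 < max x 0 + 1 := by positivity
    have h1 := h.scaledLaw_limit_Iio_le hα0 hν hc
    have hlt : x < max x 0 + 1 := by linarith [le_max_left x 0]
    rw [hx, Measure.dirac_apply' _ measurableSet_Iio, Set.indicator_of_mem (Set.mem_Iio.2 hlt), Pi.one_apply,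
      ENNReal.one_le_ofReal, Real.one_le_exp_iff] at h1
    have : 0 < (max x 0 + 1) ^ (-α) := by positivity
    linarith

end IsUnitParetoField

/-! ### Reduction to scale 1. -/

theorem paretoMeasure_Iic {x₀ α : ℝ} (hx₀ : 0 < x₀) (hα : 0 < α) (t : ℝ) :
    paretoMeasure x₀ α (Set.Iic t) = 1 - ENNReal.ofReal ((max (t / x₀) 1) ^ (-α)) := by
  have := isProbabilityMeasure_paretoMeasure hx₀ hα
  have hc : ∀ s, x₀ ≤ s →
      paretoMeasure x₀ α (Set.Iic s) = 1 - ENNReal.ofReal ((s / x₀) ^ (-α)) := fun s hs => by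
    rw [← paretoMeasure_Ioi hx₀ hα hs, ← Set.compl_Ioi, prob_compl_eq_one_sub measurableSet_Ioi]
  rcases le_total x₀ t with h | h
  · rw [hc t h, max_eq_left ((one_le_div hx₀).2 h)]
  · have h0 := hc x₀ le_rfl
    rw [div_self hx₀.ne'] at h0
    rw [max_eq_right ((div_le_one hx₀).2 h), ← h0]
    refine le_antisymm (measure_mono (Set.Iic_subset_Iic.2 h)) ?_
    rw [h0]
    simp

theorem paretoMeasure_map_div {x₀ α : ℝ} (hx₀ : 0 < x₀) (hα : 0 < α) :
    (paretoMeasure x₀ α).map (fun x => x / x₀) = paretoMeasure 1 α := by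
  have := isProbabilityMeasure_paretoMeasure hx₀ hα
  have := isProbabilityMeasure_paretoMeasure one_pos hα
  have hm : Measurable fun x : ℝ => x / x₀ := measurable_id.div_const _
  have := Measure.isProbabilityMeasure_map (μ := paretoMeasure x₀ α) hm.aemeasurable
  refine Measure.ext_of_Iic _ _ fun t => ?_
  rw [Measure.map_apply hm measurableSet_Iic, paretoMeasure_Iic one_pos hα, div_one]
  have e : (fun x : ℝ => x / x₀) ⁻¹' Set.Iic t = Set.Iic (t * x₀) := by
    ext x; simp [div_le_iff₀ hx₀]
  rw [e, paretoMeasure_Iic hx₀ hα, mul_div_cancel_right₀ _ hx₀.ne']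

theorem ae_paretoMeasure_ge {x₀ α : ℝ} : ∀ᵐ x ∂paretoMeasure x₀ α, x₀ ≤ x := by
  rw [ae_iff]
  have : {x : ℝ | ¬ x₀ ≤ x} = Set.Iio x₀ := by ext; simp
  rw [this, paretoMeasure, withDensity_apply _ measurableSet_Iio]
  exact lintegral_paretoPDF_of_le le_rfl

/-- Taking the maximum with 0 leaves the law unchanged and makes the rewards nonnegative everywhere,
not just almost surely. -/
theorem paretoMeasure_map_div_max {x₀ α : ℝ} (hx₀ : 0 < x₀) (hα : 0 < α) :
    (paretoMeasure x₀ α).map (fun x => max (x / x₀) 0) = paretoMeasure 1 α := by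
  rw [← paretoMeasure_map_div hx₀ hα]
  refine Measure.map_congr ?_
  filter_upwards [ae_paretoMeasure_ge] with x hx
  exact max_eq_left (div_nonneg (hx₀.le.trans hx) hx₀.le)

theorem isUnitParetoField_infinitePi {α : ℝ} (hα : 0 < α) :
    IsUnitParetoField α (fun v (ω : (Fin 2 → ℕ) → ℝ) => max (ω v / 1) 0)
      (Measure.infinitePi fun _ => paretoMeasure 1 α) := by
  have := isProbabilityMeasure_paretoMeasure one_pos hα
  have hm : Measurable fun x : ℝ => max (x / 1) 0 :=
    (measurable_id.div_const _).max measurable_const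
  refine ⟨fun v => hm.comp (measurable_pi_apply v), fun v ω => le_max_right _ _, ?_, fun v => ?_⟩
  · exact iIndepFun_infinitePi (P := fun _ : Fin 2 → ℕ => paretoMeasure 1 α)
      (X := fun _ x => max (x / 1) 0) fun _ => hm
  · have h := paretoMeasure_map_div_max one_pos hα
    have he := (measurePreserving_eval_infinitePi
      (fun _ : Fin 2 → ℕ => paretoMeasure 1 α) v).map_eq
    rw [← he, Measure.map_map hm (measurable_pi_apply v)] at h
    exact h.trans he

/-- Every Pareto field is almost surely a multiple of one with scale `1`. -/
theorem IsParetoField.exists_isUnitParetoField {Ω : Type*} [MeasurableSpace Ω] {P : Measure Ω}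
    {xm α : ℝ} (hxm : 0 < xm) (hα : 0 < α) {r : (Fin 2 → ℕ) → Ω → ℝ}
    (h : IsParetoField xm α r P) :
    ∃ w : (Fin 2 → ℕ) → Ω → ℝ, IsUnitParetoField α w P ∧ ∀ᵐ ω ∂P, ∀ v, r v ω = xm * w v ω := by
  have haem := fun v => (h.law v).aemeasurable
  have hm : Measurable fun x : ℝ => max (x / xm) 0 :=
    (measurable_id.div_const _).max measurable_const
  refine ⟨fun v ω => max ((haem v).mk (r v) ω / xm) 0,
    ⟨fun v => hm.comp (haem v).measurable_mk, fun v ω => le_max_right _ _, ?_, fun v => ?_⟩, ?_⟩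
  · exact (h.indep.congr fun v => (haem v).ae_eq_mk).comp (fun _ x => max (x / xm) 0) fun _ => hm
  · rw [← paretoMeasure_map_div_max hxm hα, ← (h.law v).map_eq,
      Measure.map_congr (haem v).ae_eq_mk, Measure.map_map hm (haem v).measurable_mk]
    rfl
  · rw [ae_all_iff]
    intro v
    have hge : ∀ᵐ ω ∂P, xm ≤ r v ω := by
      have := ae_paretoMeasure_ge (x₀ := xm) (α := α)
      rw [← (h.law v).map_eq] at this
      exact ae_of_ae_map (haem v) this
    filter_upwards [hge, (haem v).ae_eq_mk] with ω h1 h2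
    rw [← h2, max_eq_left (div_nonneg (hxm.le.trans h1) hxm.le)]
    field_simp

namespace IsUnitParetoField
variable {Ω : Type*} [MeasurableSpace Ω] {P : Measure Ω} {α : ℝ} {w : (Fin 2 → ℕ) → Ω → ℝ}

/-- The law depends on the field only through its joint law, a fixed product measure. Hence the
limit depends only on α. -/
theorem scaledLaw_eq [IsProbabilityMeasure P] {Ω' : Type*} [MeasurableSpace Ω'] {P' : Measure Ω'}
    [IsProbabilityMeasure P'] {w' : (Fin 2 → ℕ) → Ω' → ℝ} (h : IsUnitParetoField α w P)
    (h' : IsUnitParetoField α w' P') : h.scaledLaw = h'.scaledLaw := by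
  funext n
  refine Subtype.ext ?_
  have hg : Measurable fun x : (Fin 2 → ℕ) → ℝ => chainMax (· ≤ ·) x n / (n : ℝ) ^ (2 / α) :=
    (LatticeReward.measurable_chainMax _ n).div_const _
  have e1 := Measure.map_map (μ := P) hg (measurable_pi_lambda _ h.meas)
  have e2 := Measure.map_map (μ := P') hg (measurable_pi_lambda _ h'.meas)
  rw [h.map_eq] at e1
  rw [h'.map_eq] at e2
  exact e1.symm.trans e2

theorem tendstoInDistribution [IsProbabilityMeasure P] (h : IsUnitParetoField α w P)
    {ν : ProbabilityMeasure ℝ} (hν : Tendsto h.scaledLaw atTop (𝓝 ν)) :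
    TendstoInDistribution
      (fun (n : ℕ) ω => chainMax (· ≤ ·) (fun v => w v ω) n / (n : ℝ) ^ (2 / α)) atTop
      (fun t : ℝ => t) (fun _ => P) (ν : Measure ℝ) where
  forall_aemeasurable n := (h.measurable_scaled n).aemeasurable
  aemeasurable_limit := aemeasurable_id
  tendsto := by
    have e : (⟨(ν : Measure ℝ).map fun t : ℝ => t,
        Measure.isProbabilityMeasure_map aemeasurable_id⟩ : ProbabilityMeasure ℝ) = ν :=
      Subtype.ext Measure.map_id
    rw [e]
    exact hν

theorem measureReal_between_ge [IsProbabilityMeasure P] (h : IsUnitParetoField α w P)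
    {c C N ε : ℝ} {n : ℕ}
    (hc : P.real {ω | chainMax (· ≤ ·) (fun v => w v ω) n ≤ c * N} ≤ ε / 2)
    (hC : P.real {ω | C * N < chainMax (· ≤ ·) (fun v => w v ω) n} ≤ ε / 2) :
    1 - ε ≤ P.real {ω | c * N ≤ chainMax (· ≤ ·) (fun v => w v ω) n ∧
      chainMax (· ≤ ·) (fun v => w v ω) n ≤ C * N} := by
  have hX := h.measurable_chainMax (· ≤ ·) n
  set S := {ω | c * N ≤ chainMax (· ≤ ·) (fun v => w v ω) n ∧
      chainMax (· ≤ ·) (fun v => w v ω) n ≤ C * N} with hS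
  have hSm : MeasurableSet S :=
    (measurableSet_le measurable_const hX).inter (measurableSet_le hX measurable_const)
  have hsub : Sᶜ ⊆ {ω | chainMax (· ≤ ·) (fun v => w v ω) n ≤ c * N} ∪
      {ω | C * N < chainMax (· ≤ ·) (fun v => w v ω) n} := by
    intro ω hω
    by_contra hnot
    rw [Set.mem_union, not_or] at hnot
    exact hω ⟨(not_le.1 hnot.1).le, not_lt.1 hnot.2⟩
  have h1 := (measureReal_mono (μ := P) hsub).trans (measureReal_union_le _ _)
  rw [probReal_compl_eq_one_sub hSm] at h1
  linarith

end IsUnitParetoField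

/-! ### The mean reward and the final assembly. -/

theorem Rstar_div {α : ℝ} (hα : 0 < α) (w : (Fin 2 → ℕ) → ℝ) (n : ℕ) :
    Rstar w n / (n : ℝ) ^ (2 / α - 1) = Tstar w n / (n : ℝ) ^ (2 / α) := by
  rcases Nat.eq_zero_or_pos n with rfl | hn
  · have : 2 / α ≠ 0 := by positivity
    simp [Rstar, Real.zero_rpow this]
  · have hn0 : (0 : ℝ) < n := by exact_mod_cast hn
    rw [Rstar, Real.rpow_sub_one hn0.ne']
    field_simp

theorem mul_rpow_sub_one_le_Rstar_iff {α c : ℝ} (w : (Fin 2 → ℕ) → ℝ) {n : ℕ} (hn : 1 ≤ n) :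
    (c * (n : ℝ) ^ (2 / α - 1) ≤ Rstar w n ↔ c * (n : ℝ) ^ (2 / α) ≤ Tstar w n) ∧
    (Rstar w n ≤ c * (n : ℝ) ^ (2 / α - 1) ↔ Tstar w n ≤ c * (n : ℝ) ^ (2 / α)) := by
  have hn0 : (0 : ℝ) < n := by exact_mod_cast hn
  rw [Rstar, Real.rpow_sub_one hn0.ne', ← mul_div_assoc, div_le_div_iff_of_pos_right hn0,
    div_le_div_iff_of_pos_right hn0]
  exact ⟨Iff.rfl, Iff.rfl⟩

/-- By Markov's inequality the mean is eventually at least b n / 2. -/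
theorem tendsto_lintegral_top {Ω : Type*} [MeasurableSpace Ω] {P : Measure Ω}
    [IsProbabilityMeasure P] {X : ℕ → Ω → ℝ} (hX : ∀ n, AEMeasurable (X n) P) {b : ℕ → ℝ}
    (hb : Tendsto b atTop atTop) (h : ∀ n, 1 ≤ n → 1 / 2 ≤ P.real {ω | b n ≤ X n ω}) :
    Tendsto (fun n => ∫⁻ ω, ENNReal.ofReal (X n ω) ∂P) atTop (𝓝 ⊤) := by
  have hlim : Tendsto (fun n => ENNReal.ofReal (b n * (1 / 2))) atTop (𝓝 ⊤) :=
    ENNReal.tendsto_ofReal_atTop.comp (hb.atTop_mul_const (by norm_num))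
  refine tendsto_nhds_top_mono hlim ?_
  filter_upwards [eventually_ge_atTop 1, hb.eventually_ge_atTop 0] with n hn hbn
  refine le_trans ?_ (mul_meas_ge_le_lintegral₀ (hX n).ennreal_ofReal (ENNReal.ofReal (b n)))
  rw [ENNReal.ofReal_mul hbn]
  refine mul_le_mul_right ?_ _
  refine ((ENNReal.ofReal_le_iff_le_toReal (measure_ne_top _ _)).2 (h n hn)).trans
    (measure_mono fun ω hω => ENNReal.ofReal_le_ofReal hω)

end LatticeReward

open LatticeReward in
theorem mainTheorem7 (α : ℝ) (hα0 : 0 < α) (hα2 : α < 2) :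
    ∃ (ν : ProbabilityMeasure ℝ) (c C : ℝ → ℝ),
      (ν : Measure ℝ) (Set.Iic 0) = 0 ∧
      (∀ x : ℝ, (ν : Measure ℝ) ≠ Measure.dirac x) ∧
      (∀ ε : ℝ, 0 < ε → 0 < c ε ∧ 0 < C ε) ∧
      ∀ (xm : ℝ), 0 < xm →
      ∀ (Ω : Type*) [MeasurableSpace Ω] (P : Measure Ω) [IsProbabilityMeasure P]
        (r : (Fin 2 → ℕ) → Ω → ℝ), LatticeReward.IsParetoField xm α r P →
        Tendsto (fun n : ℕ =>
            ∫⁻ ω, ENNReal.ofReal (LatticeReward.Rstar (fun v => r v ω) n) ∂P) atTop (𝓝 ⊤) ∧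
        (∀ ε : ℝ, 0 < ε → ∀ n : ℕ, 1 ≤ n →
          1 - ε ≤ P.real {ω |
            c ε * xm * (n : ℝ) ^ (2 / α) ≤ LatticeReward.Tstar (fun v => r v ω) n ∧
            LatticeReward.Tstar (fun v => r v ω) n ≤ C ε * xm * (n : ℝ) ^ (2 / α)}) ∧
        (∀ ε : ℝ, 0 < ε → ∀ n : ℕ, 1 ≤ n →
          1 - ε ≤ P.real {ω |
            c ε * xm * (n : ℝ) ^ (2 / α - 1) ≤ LatticeReward.Rstar (fun v => r v ω) n ∧
            LatticeReward.Rstar (fun v => r v ω) n ≤ C ε * xm * (n : ℝ) ^ (2 / α - 1)}) ∧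
        TendstoInDistribution
          (fun (n : ℕ) ω => LatticeReward.Tstar (fun v => r v ω) n / (n : ℝ) ^ (2 / α))
          atTop (fun t : ℝ => xm * t) (fun _ => P) (ν : Measure ℝ) ∧
        TendstoInDistribution
          (fun (n : ℕ) ω => LatticeReward.Rstar (fun v => r v ω) n / (n : ℝ) ^ (2 / α - 1))
          atTop (fun t : ℝ => xm * t) (fun _ => P) (ν : Measure ℝ) := by
  have := isProbabilityMeasure_paretoMeasure one_pos hα0
  have h₀ := isUnitParetoField_infinitePi hα0
  -- The limit law is built on the canonical product space, before any particular field is given.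
  obtain ⟨ν, hν⟩ := h₀.exists_tendsto_scaledLaw hα0 hα2
  obtain ⟨hν0, hνdirac⟩ := h₀.scaledLaw_limit_nontrivial hα0 hν
  choose c hc0 hc using fun ε : {ε : ℝ // 0 < ε} => exists_lower_const hα0 (half_pos ε.2)
  choose C hC0 hC using fun ε : {ε : ℝ // 0 < ε} => exists_upper_const hα0 hα2 (half_pos ε.2)
  -- The value 1 for nonpositive ε is arbitrary.
  refine ⟨ν, fun ε => if h : 0 < ε then c ⟨ε, h⟩ else 1, fun ε => if h : 0 < ε then C ⟨ε, h⟩ else 1,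
    hν0, hνdirac, fun ε hε => ?_, fun xm hxm Ω _ P _ r hr => ?_⟩
  · simp only [hε, dif_pos]
    exact ⟨hc0 _, hC0 _⟩
  obtain ⟨w, hw, hrw⟩ := hr.exists_isUnitParetoField hxm hα0
  rw [h₀.scaledLaw_eq hw] at hν
  have hT : ∀ᵐ ω ∂P, ∀ n, Tstar (fun v => r v ω) n = xm * chainMax (· ≤ ·) (fun v => w v ω) n := by
    filter_upwards [hrw] with ω hω n
    rw [funext hω, Tstar_eq_chainMax fun v => mul_nonneg hxm.le (hw.nonneg v ω),
      chainMax_const_mul hxm.le]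
  have htwo : ∀ ε : ℝ, ∀ hε : 0 < ε, ∀ n : ℕ, 1 ≤ n →
      1 - ε ≤ P.real {ω | c ⟨ε, hε⟩ * xm * (n : ℝ) ^ (2 / α) ≤ Tstar (fun v => r v ω) n ∧
        Tstar (fun v => r v ω) n ≤ C ⟨ε, hε⟩ * xm * (n : ℝ) ^ (2 / α)} := by
    intro ε hε n hn
    refine (hw.measureReal_between_ge (hc ⟨ε, hε⟩ hw n hn) (hC ⟨ε, hε⟩ hw n hn)).trans
      (le_of_eq (measureReal_congr ?_))
    filter_upwards [hT] with ω hω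
    refine propext ?_
    change (_ ∧ _) ↔ (_ ∧ _)
    rw [hω n, mul_comm _ xm, mul_comm _ xm, mul_assoc, mul_assoc, mul_le_mul_iff_right₀ hxm,
      mul_le_mul_iff_right₀ hxm]
  have hdist : TendstoInDistribution
      (fun (n : ℕ) ω => Tstar (fun v => r v ω) n / (n : ℝ) ^ (2 / α))
      atTop (fun t : ℝ => xm * t) (fun _ => P) (ν : Measure ℝ) := by
    refine TendstoInDistribution.congr (fun n => ?_) (ae_of_all _ fun _ => rfl)
      ((hw.tendstoInDistribution hν).continuous_comp (g := fun t : ℝ => xm * t)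
        (continuous_const.mul continuous_id))
    filter_upwards [hT] with ω hω
    simp only [Function.comp_apply]
    rw [hω n, mul_div_assoc]
  refine ⟨?_, fun ε hε n hn => ?_, fun ε hε n hn => ?_, hdist, ?_⟩
  · have hα' : 0 < 2 / α - 1 := by rw [sub_pos, lt_div_iff₀ hα0]; linarith
    -- The lower bound with ε = 1/2 holds with probability at least 1/2 and diverges since 2/α - 1 >
    -- 0.
    refine tendsto_lintegral_top
      (b := fun n => c ⟨1 / 2, by norm_num⟩ * xm * (n : ℝ) ^ (2 / α - 1)) (fun n => ?_) ?_
      fun n hn => ?_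
    · refine AEMeasurable.div_const ?_ _
      exact ((hw.measurable_chainMax (· ≤ ·) n).const_mul xm).aemeasurable.congr
        (hT.mono fun ω hω => (hω n).symm)
    · exact ((tendsto_rpow_atTop hα').comp tendsto_natCast_atTop_atTop).const_mul_atTop
        (mul_pos (hc0 _) hxm)
    · refine le_trans (by norm_num) ((htwo (1 / 2) (by norm_num) n hn).trans
        (measureReal_mono fun ω hω => ?_))
      exact (mul_rpow_sub_one_le_Rstar_iff _ hn).1.2 hω.1
  · simp only [hε, dif_pos]
    exact htwo ε hε n hn
  · simp only [hε, dif_pos]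
    refine (htwo ε hε n hn).trans (measureReal_mono fun ω hω => ?_)
    exact ⟨(mul_rpow_sub_one_le_Rstar_iff _ hn).1.2 hω.1,
      (mul_rpow_sub_one_le_Rstar_iff _ hn).2.2 hω.2⟩
  · simp only [Rstar_div hα0]
    exact hdist
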